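/- Let $\Bbbk$ be a field of characteristic zero and $H=\Bbbk[\partial]$; write $\partial^{(s)}=\partial^s/s!$. An associative conformal algebra is an $H$-module $C$ with $\Bbbk$-bilinear products $(\cdot_{(n)}\cdot)$, $n\in\mathbb Z_+$, such that for all $x,y,z\in C$ and $n,m\in\mathbb Z_+$: $x_{(n)}y=0$ for $n\gg0$; $(\partial x)_{(n)}y=-n\,x_{(n-1)}y$ and $x_{(n)}\partial y=\partial(x_{(n)}y)+n\,x_{(n-1)}y$; and $x_{(n)}(y_{(m)}z)=\sum_{s\ge0}\binom ns (x_{(s)}y)_{(n+m-s)}z$. Its commutator products are $[x_{(n)}y]=x_{(n)}y-\sum_{s\ge0}(-1)^{n+s}\partial^{(s)}(y_{(n+s)}x)$, and $C^{(-)}$ denotes $C$ with these products. The Virasoro conformal algebra $\mathrm{Vir}=Hv$ is the free $H$-module of rank one with the Lie conformal algebra structure determined by $[v_\lambda v]=\sum_{n\ge 0}\frac{\lambda^n}{n!}[v_{(n)}v]=(\partial+2\lambda)v$. Let $U=U(\mathrm{Vir};v,3)$ be its universal associative envelope with locality bound $3$: $U$ is universal among the associative conformal algebras $C$ equipped with a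 homomorphism $\varphi:\mathrm{Vir}\to C^{(-)}$ such that $\varphi(\mathrm{Vir})$ generates $C$ as a conformal algebra and $\varphi(v)_{(n)}\varphi(v)=0$ for all $n\ge3$. Denote the image of $v$ in $U$ again by $v$ and put $L_n u=v_{(n)}u$ for $u\in U$; powers of $L_n$ are powers of this operator. Then the elements $$L_0^n\,\partial^s L_1^m v\quad(n,s,m\ge0),\qquad L_0^nL_1^mL_2v\quad(n,m\ge0)$$ form a linear basis of $U$ over $\Bbbk$ (elements with different indices are distinct). Moreover, $U$ is a free $H$-module with basis $$x_{n+1}=L_0^nv\quad(n\ge0),\qquad y_{n+1,m+1}=L_0^nL_1^mL_2v\quad(n,m\ge0).$$ -/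

import Mathlib

open Polynomial

noncomputable section

/-- The structure shared by Lie and associative conformal algebras: a `k[∂]`-module `C` (a `k`-space
with the endomorphism `der`, the action of `∂`) and bilinear products `prod n x y = (x_(n) y)`,
which are local and sesquilinear. -/
class ConformalAlgebra (k : Type*) [Field k] (C : Type*) [AddCommGroup C] [Module k C] where
  der : C →ₗ[k] C
  prod : ℕ → C →ₗ[k] C →ₗ[k] C
  locality : ∀ x y : C, ∃ N : ℕ, ∀ n, N ≤ n → prod n x y = 0
  prod_der_left : ∀ (n : ℕ) (x y : C), prod n (der x) y = -((n : k) • prod (n - 1) x y)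
  prod_der_right : ∀ (n : ℕ) (x y : C),
    prod n x (der y) = der (prod n x y) + (n : k) • prod (n - 1) x y

namespace ConformalAlgebra

section Basics

variable (k : Type*) [Field k] {C : Type*} [AddCommGroup C] [Module k C] [ConformalAlgebra k C]

/-- The divided power `∂^(s) = ∂^s / s!`. -/
def divDer (s : ℕ) : C →ₗ[k] C := ((s.factorial : k)⁻¹) • (der (k := k) (C := C)) ^ s

/-- `{y_(n) x} = ∑_{s ≥ 0} (-1)^(n+s) ∂^(s) (y_(n+s) x)`; by locality the sum is finite. -/
def curly (n : ℕ) (y x : C) : C :=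
  ∑ᶠ s : ℕ, ((-1 : k) ^ (n + s)) • divDer k s (prod (k := k) (n + s) y x)

/-- The subset `X` generates `C` as a `k[∂]`-module. -/
def GeneratesModule (X : Set C) : Prop :=
  ∀ p : Submodule k C, X ⊆ p → (∀ x ∈ p, der (k := k) x ∈ p) → p = ⊤

/-- The subset `X` generates `C` as a conformal algebra. -/
def GeneratesAlgebra (X : Set C) : Prop :=
  ∀ p : Submodule k C, X ⊆ p → (∀ x ∈ p, der (k := k) x ∈ p) →
    (∀ n, ∀ x ∈ p, ∀ y ∈ p, prod (k := k) n x y ∈ p) → p = ⊤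

variable {k}

theorem curly_eq_sum {y x : C} {B : ℕ} (hB : ∀ n, B ≤ n → prod (k := k) n y x = 0)
    (n K : ℕ) (hK : B ≤ n + K) :
    curly k n y x = ∑ s ∈ Finset.range K,
      ((-1 : k) ^ (n + s)) • divDer k s (prod (k := k) (n + s) y x) := by
  refine finsum_eq_sum_of_support_subset _ fun s hs => ?_
  by_contra hsK
  apply hs
  have : K ≤ s := by simpa using hsK
  simp [hB (n + s) (by omega)]

theorem der_divDer [CharZero k] (s : ℕ) (x : C) :
    der (k := k) (divDer k s x) = ((s : k) + 1) • divDer k (s + 1) x := by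
  have h1 : (s.factorial : k) ≠ 0 := by exact_mod_cast s.factorial_ne_zero
  have h2 : ((s : k) + 1) ≠ 0 := by exact_mod_cast s.succ_ne_zero
  simp only [divDer, LinearMap.smul_apply, map_smul, Nat.factorial_succ, smul_smul, pow_succ',
    Module.End.mul_apply]
  congr 1
  push_cast
  field_simp

theorem divDer_der [CharZero k] (s : ℕ) (x : C) :
    divDer k s (der (k := k) x) = ((s : k) + 1) • divDer k (s + 1) x := by
  rw [← der_divDer]
  simp only [divDer, LinearMap.smul_apply, map_smul]
  congr 1
  rw [← Module.End.mul_apply, ← Module.End.mul_apply, ← pow_succ, ← pow_succ']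

theorem curly_add_left (n : ℕ) (y y' x : C) :
    curly k n (y + y') x = curly k n y x + curly k n y' x := by
  obtain ⟨B, hB⟩ := locality (k := k) y x
  obtain ⟨B', hB'⟩ := locality (k := k) y' x
  rw [curly_eq_sum (B := B) hB n (B + B') (by omega),
    curly_eq_sum (B := B') hB' n (B + B') (by omega),
    curly_eq_sum (B := B + B') (fun m hm => by
      simp [hB m (by omega), hB' m (by omega)]) n (B + B') (by omega)]
  simp [Finset.sum_add_distrib]

theorem curly_add_right (n : ℕ) (y x x' : C) :
    curly k n y (x + x') = curly k n y x + curly k n y x' := by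
  obtain ⟨B, hB⟩ := locality (k := k) y x
  obtain ⟨B', hB'⟩ := locality (k := k) y x'
  rw [curly_eq_sum (B := B) hB n (B + B') (by omega),
    curly_eq_sum (B := B') hB' n (B + B') (by omega),
    curly_eq_sum (B := B + B') (fun m hm => by
      simp [hB m (by omega), hB' m (by omega)]) n (B + B') (by omega)]
  simp [Finset.sum_add_distrib]

theorem curly_smul_left (n : ℕ) (c : k) (y x : C) :
    curly k n (c • y) x = c • curly k n y x := by
  obtain ⟨B, hB⟩ := locality (k := k) y x
  rw [curly_eq_sum (B := B) hB n B (by omega),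
    curly_eq_sum (B := B) (fun m hm => by simp [hB m hm]) n B (by omega)]
  simp [Finset.smul_sum, smul_comm c]

theorem curly_smul_right (n : ℕ) (c : k) (y x : C) :
    curly k n y (c • x) = c • curly k n y x := by
  obtain ⟨B, hB⟩ := locality (k := k) y x
  rw [curly_eq_sum (B := B) hB n B (by omega),
    curly_eq_sum (B := B) (fun m hm => by simp [hB m hm]) n B (by omega)]
  simp [Finset.smul_sum, smul_comm c]

theorem curly_der_right [CharZero k] (n : ℕ) (y x : C) :
    curly k n y (der (k := k) x) = -((n : k) • curly k (n - 1) y x) := by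
  obtain ⟨B, hB⟩ := locality (k := k) y x
  have hB' : ∀ m, B + 1 ≤ m → prod (k := k) m y (der (k := k) x) = 0 := fun m hm => by
    rw [prod_der_right, hB m (by omega), hB (m - 1) (by omega)]; simp
  rw [curly_eq_sum hB' n (B + 1) (by omega), curly_eq_sum hB (n - 1) (B + 1) (by omega)]
  let f : ℕ → C := fun t => ((-1 : k) ^ (n + t) * (t : k)) •
    divDer k t (prod (k := k) (n + t - 1) y x)
  have hf : ∑ s ∈ Finset.range (B + 1), (f (s + 1) - f s) = 0 := by
    rw [Finset.sum_range_sub]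
    simp [f, hB (n + B) (by omega)]
  rw [Finset.smul_sum, ← Finset.sum_neg_distrib, ← add_zero (Finset.sum _ _), ← hf,
    ← Finset.sum_add_distrib]
  refine Finset.sum_congr rfl fun s _ => ?_
  have e1 : n + (s + 1) - 1 = n + s := by omega
  simp only [f, prod_der_right, map_add, map_smul, divDer_der, e1]
  rcases Nat.eq_zero_or_pos n with rfl | hn
  · simp only [pow_add, pow_one]
    push_cast
    module
  · obtain ⟨n, rfl⟩ := Nat.exists_eq_succ_of_ne_zero hn.ne'
    have e2 : n.succ + s - 1 = n + s := by omega
    have e3 : n.succ - 1 + s = n + s := by omega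
    simp only [e2, e3, Nat.succ_eq_add_one, pow_add, pow_one]
    push_cast
    module

theorem curly_der_left [CharZero k] (n : ℕ) (y x : C) :
    curly k n (der (k := k) y) x =
      der (k := k) (curly k n y x) + (n : k) • curly k (n - 1) y x := by
  obtain ⟨B, hB⟩ := locality (k := k) y x
  have hB' : ∀ m, B + 1 ≤ m → prod (k := k) m (der (k := k) y) x = 0 := fun m hm => by
    rw [prod_der_left, hB (m - 1) (by omega)]; simp
  rw [curly_eq_sum hB' n (B + 1) (by omega), curly_eq_sum hB n (B + 1) (by omega),
    curly_eq_sum hB (n - 1) (B + 1) (by omega)]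
  let f : ℕ → C := fun t => ((-1 : k) ^ (n + t) * (t : k)) •
    divDer k t (prod (k := k) (n + t - 1) y x)
  have hf : ∑ s ∈ Finset.range (B + 1), (f s - f (s + 1)) = 0 := by
    rw [Finset.sum_range_sub']
    simp [f, hB (n + B) (by omega)]
  rw [Finset.smul_sum, map_sum, ← Finset.sum_add_distrib, ← add_zero (Finset.sum _ _), ← hf,
    ← Finset.sum_add_distrib]
  refine Finset.sum_congr rfl fun s _ => ?_
  have e1 : n + (s + 1) - 1 = n + s := by omega
  simp only [f, prod_der_left, map_neg, map_smul, der_divDer, e1]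
  rcases Nat.eq_zero_or_pos n with rfl | hn
  · simp only [pow_add, pow_one]
    push_cast
    module
  · obtain ⟨n, rfl⟩ := Nat.exists_eq_succ_of_ne_zero hn.ne'
    have e2 : n.succ + s - 1 = n + s := by omega
    have e3 : n.succ - 1 + s = n + s := by omega
    simp only [e2, e3, Nat.succ_eq_add_one, pow_add, pow_one]
    push_cast
    module

/-- The right-hand side of the associativity and of the Jacobi identities. -/
def nested (n m : ℕ) (x y z : C) : C :=
  ∑ s ∈ Finset.range (n + 1),
    (n.choose s : k) • prod (k := k) (n + m - s) (prod (k := k) s x y) z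

theorem nested_der_left (n m : ℕ) (x y z : C) :
    nested (k := k) n m (der (k := k) x) y z = -((n : k) • nested (k := k) (n - 1) m x y z) := by
  rcases n with _ | n
  · simp [nested, prod_der_left]
  · rw [nested, nested, Finset.sum_range_succ', Nat.add_sub_cancel, Finset.smul_sum,
      ← Finset.sum_neg_distrib]
    simp only [prod_der_left, Nat.cast_zero, zero_smul, neg_zero, map_zero, LinearMap.zero_apply,
      smul_zero, add_zero]
    refine Finset.sum_congr rfl fun s _ => ?_
    have e : n + 1 + m - (s + 1) = n + m - s := by omega
    have h : ((n : k) + 1) * (n.choose s : k) = ((n + 1).choose (s + 1) : k) * ((s : k) + 1) := by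
      simpa using congrArg (Nat.cast : ℕ → k) (Nat.add_one_mul_choose_eq n s)
    simp only [e, Nat.add_sub_cancel, map_neg, map_smul, LinearMap.neg_apply,
      LinearMap.smul_apply, smul_neg, smul_smul]
    push_cast
    rw [h]

theorem nested_der_mid (n m : ℕ) (x y z : C) :
    nested (k := k) n m x (der (k := k) y) z = -((m : k) • nested (k := k) n (m - 1) x y z) := by
  let g : ℕ → C := fun t => ((t : k) * (n.choose t : k)) •
    prod (k := k) (n + m - t) (prod (k := k) (t - 1) x y) z
  have hg : ∑ s ∈ Finset.range (n + 1), (g (s + 1) - g s) = 0 := by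
    rw [Finset.sum_range_sub]
    simp [g]
  rw [nested, nested, Finset.smul_sum, ← Finset.sum_neg_distrib, ← add_zero (Finset.sum _ _), ← hg,
    ← Finset.sum_add_distrib]
  refine Finset.sum_congr rfl fun s hs => ?_
  have hs' : s ≤ n := by simpa [Nat.lt_succ_iff] using hs
  have e : n + m - (s + 1) = n + m - s - 1 := by omega
  have h : (n.choose (s + 1) : k) * ((s : k) + 1) = (n.choose s : k) * ((n : k) - (s : k)) := by
    rw [← Nat.cast_sub hs']
    simpa using congrArg (Nat.cast : ℕ → k) (Nat.choose_succ_right_eq n s)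
  have h' : ((s : k) + 1) * (n.choose (s + 1) : k) = (n.choose s : k) * ((n : k) - (s : k)) := by
    rw [mul_comm, h]
  have hm : (m : k) • (n.choose s : k) • prod (k := k) (n + (m - 1) - s) (prod (k := k) s x y) z =
      (m : k) • (n.choose s : k) • prod (k := k) (n + m - s - 1) (prod (k := k) s x y) z := by
    rcases m with _ | m
    · simp
    · rw [show n + (m + 1 - 1) - s = n + (m + 1) - s - 1 by omega]
  have hc : ((n + m - s : ℕ) : k) = (n : k) + (m : k) - (s : k) := by
    rw [Nat.cast_sub (by omega), Nat.cast_add]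
  rw [hm]
  simp only [g, e, prod_der_right, prod_der_left, map_add, map_smul, LinearMap.add_apply,
    LinearMap.smul_apply, Nat.add_sub_cancel, hc, Nat.cast_add, Nat.cast_one, h']
  module

theorem nested_der_right (n m : ℕ) (x y z : C) :
    nested (k := k) n m x y (der (k := k) z) = der (k := k) (nested (k := k) n m x y z) +
      (n : k) • nested (k := k) (n - 1) m x y z + (m : k) • nested (k := k) n (m - 1) x y z := by
  have hn : (n : k) • nested (k := k) (n - 1) m x y z = ∑ s ∈ Finset.range (n + 1),
      ((n.choose s : k) * ((n : k) - (s : k))) •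
        prod (k := k) (n + m - s - 1) (prod (k := k) s x y) z := by
    rcases n with _ | n
    · simp
    · rw [Finset.sum_range_succ, nested, Finset.smul_sum, sub_self, mul_zero, zero_smul, add_zero]
      refine Finset.sum_congr rfl fun s hs => ?_
      have hs' : s < n + 1 := by simpa using hs
      have h : (n.choose s : k) * ((n : k) + 1) =
          ((n + 1).choose s : k) * ((n : k) + 1 - (s : k)) := by
        have := Nat.choose_mul_succ_eq n s
        have h2 : ((n + 1 - s : ℕ) : k) = (n : k) + 1 - (s : k) := by
          rw [Nat.cast_sub (by omega)]; push_cast; rfl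
        rw [← h2]
        simpa using congrArg (Nat.cast : ℕ → k) this
      have e : n + 1 + m - s - 1 = n + 1 - 1 + m - s := by omega
      rw [e, smul_smul]
      simp only [Nat.add_sub_cancel, Nat.cast_add, Nat.cast_one]
      rw [← h, mul_comm]
  have hm : (m : k) • nested (k := k) n (m - 1) x y z = ∑ s ∈ Finset.range (n + 1),
      ((m : k) * (n.choose s : k)) •
        prod (k := k) (n + m - s - 1) (prod (k := k) s x y) z := by
    rcases m with _ | m
    · simp
    · rw [nested, Finset.smul_sum]
      refine Finset.sum_congr rfl fun s hs => ?_
      rw [smul_smul, show n + (m + 1 - 1) - s = n + (m + 1) - s - 1 by omega]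
  rw [hn, hm, nested, nested, map_sum, ← Finset.sum_add_distrib, ← Finset.sum_add_distrib]
  refine Finset.sum_congr rfl fun s hs => ?_
  have hs' : s ≤ n := by simpa [Nat.lt_succ_iff] using hs
  have hc : ((n + m - s : ℕ) : k) = (n : k) + (m : k) - (s : k) := by
    rw [Nat.cast_sub (by omega), Nat.cast_add]
  rw [prod_der_right, map_smul, hc]
  module

theorem nested_add_left (n m : ℕ) (x x' y z : C) :
    nested (k := k) n m (x + x') y z = nested (k := k) n m x y z + nested (k := k) n m x' y z := by
  simp [nested, Finset.sum_add_distrib]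

theorem nested_add_mid (n m : ℕ) (x y y' z : C) :
    nested (k := k) n m x (y + y') z = nested (k := k) n m x y z + nested (k := k) n m x y' z := by
  simp [nested, Finset.sum_add_distrib]

theorem nested_add_right (n m : ℕ) (x y z z' : C) :
    nested (k := k) n m x y (z + z') = nested (k := k) n m x y z + nested (k := k) n m x y z' := by
  simp [nested, Finset.sum_add_distrib]

theorem nested_smul_left (n m : ℕ) (c : k) (x y z : C) :
    nested (k := k) n m (c • x) y z = c • nested (k := k) n m x y z := by
  simp [nested, Finset.smul_sum, smul_comm c]

theorem nested_smul_mid (n m : ℕ) (c : k) (x y z : C) :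
    nested (k := k) n m x (c • y) z = c • nested (k := k) n m x y z := by
  simp [nested, Finset.smul_sum, smul_comm c]

theorem nested_smul_right (n m : ℕ) (c : k) (x y z : C) :
    nested (k := k) n m x y (c • z) = c • nested (k := k) n m x y z := by
  simp [nested, Finset.smul_sum, smul_comm c]

end Basics

/-- Lie conformal algebras: anti-commutativity and the Jacobi identity. -/
class IsLie (k : Type*) [Field k] (L : Type*) [AddCommGroup L] [Module k L]
    [ConformalAlgebra k L] : Prop where
  anticomm : ∀ (n : ℕ) (x y : L), prod (k := k) n x y = -curly k n y x
  jacobi : ∀ (n m : ℕ) (x y z : L),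
    prod (k := k) n x (prod (k := k) m y z) - prod (k := k) m y (prod (k := k) n x z) =
      ∑ s ∈ Finset.range (n + 1),
        (n.choose s : k) • prod (k := k) (n + m - s) (prod (k := k) s x y) z

/-- Associative conformal algebras. -/
class IsAssociative (k : Type*) [Field k] (C : Type*) [AddCommGroup C] [Module k C]
    [ConformalAlgebra k C] : Prop where
  assoc : ∀ (n m : ℕ) (x y z : C),
    prod (k := k) n x (prod (k := k) m y z) =
      ∑ s ∈ Finset.range (n + 1),
        (n.choose s : k) • prod (k := k) (n + m - s) (prod (k := k) s x y) z

section Envelopes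

variable {k : Type*} [Field k]
variable {L : Type*} [AddCommGroup L] [Module k L] [ConformalAlgebra k L]
variable {C : Type*} [AddCommGroup C] [Module k C] [ConformalAlgebra k C]
variable {D : Type*} [AddCommGroup D] [Module k D] [ConformalAlgebra k D]

/-- `f` is a homomorphism of conformal algebras. -/
structure IsHom (f : C →ₗ[k] D) : Prop where
  map_der : ∀ x, f (der (k := k) x) = der (k := k) (f x)
  map_prod : ∀ n x y, f (prod (k := k) n x y) = prod (k := k) n (f x) (f y)

/-- `φ : L → C^(-)` is a homomorphism, where `C^(-)` is `C` with the commutator products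
`[x_(n) y] = (x_(n) y) - {y_(n) x}`. -/
structure IsCommutatorHom (φ : L →ₗ[k] C) : Prop where
  map_der : ∀ x, φ (der (k := k) x) = der (k := k) (φ x)
  map_prod : ∀ n x y, φ (prod (k := k) n x y) =
    prod (k := k) n (φ x) (φ y) - curly k n (φ y) (φ x)

/-- `(C, φ)` is an associative envelope of `L` whose locality function on `X` is bounded by `N`. -/
structure IsEnvelope (X : Set L) (N : X → X → ℕ) (φ : L →ₗ[k] C) : Prop where
  associative : IsAssociative k C
  hom : IsCommutatorHom φ
  generates : GeneratesAlgebra k (Set.range φ)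
  local_le : ∀ (x y : X) (n : ℕ), N x y ≤ n → prod (k := k) n (φ x) (φ y) = 0

/-- Non-associative words in the letters `L`, the unary operation `∂` and the `n`-th products. -/
inductive Word (L : Type*) : Type _
  | of (l : L) : Word L
  | der (a : Word L) : Word L
  | prod (n : ℕ) (a b : Word L) : Word L

/-- The free `k`-space on the words. -/
abbrev FreeWords (k : Type*) [Field k] (L : Type*) : Type _ := Word L →₀ k

namespace FreeWords

variable (k) in
def of (l : L) : FreeWords k L := Finsupp.single (Word.of l) 1

def der : FreeWords k L →ₗ[k] FreeWords k L := Finsupp.lmapDomain k k Word.der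

def prod (n : ℕ) : FreeWords k L →ₗ[k] FreeWords k L →ₗ[k] FreeWords k L :=
  Finsupp.linearCombination k fun a => Finsupp.lmapDomain k k (Word.prod n a)

def divDer (s : ℕ) : FreeWords k L →ₗ[k] FreeWords k L :=
  ((s.factorial : k)⁻¹) • (der : FreeWords k L →ₗ[k] FreeWords k L) ^ s

end FreeWords

/-- The defining relations of `U(L; X, N)`. -/
inductive EnvRel (X : Set L) (N : X → X → ℕ) : FreeWords k L → Prop
  | add (l l' : L) : EnvRel X N (FreeWords.of k (l + l') - FreeWords.of k l - FreeWords.of k l')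
  | smul (c : k) (l : L) : EnvRel X N (FreeWords.of k (c • l) - c • FreeWords.of k l)
  | der (l : L) : EnvRel X N
      (FreeWords.of k (der (k := k) l) - FreeWords.der (FreeWords.of k l))
  | prod_der_left (n : ℕ) (a b : FreeWords k L) : EnvRel X N
      (FreeWords.prod n (FreeWords.der a) b + (n : k) • FreeWords.prod (n - 1) a b)
  | prod_der_right (n : ℕ) (a b : FreeWords k L) : EnvRel X N
      (FreeWords.prod n a (FreeWords.der b) - FreeWords.der (FreeWords.prod n a b)
        - (n : k) • FreeWords.prod (n - 1) a b)
  | assoc (n m : ℕ) (a b c : FreeWords k L) : EnvRel X N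
      (FreeWords.prod n a (FreeWords.prod m b c) - ∑ s ∈ Finset.range (n + 1),
        (n.choose s : k) • FreeWords.prod (n + m - s) (FreeWords.prod s a b) c)
  | loc (x y : X) (n : ℕ) (h : N x y ≤ n) : EnvRel X N
      (FreeWords.prod n (FreeWords.of k (x : L)) (FreeWords.of k (y : L)))
  | comm (x y : X) (n : ℕ) : EnvRel X N
      (FreeWords.of k (prod (k := k) n (x : L) (y : L)) -
        (FreeWords.prod n (FreeWords.of k (x : L)) (FreeWords.of k (y : L)) -
          ∑ s ∈ Finset.range (N y x - n), ((-1 : k) ^ (n + s)) • FreeWords.divDer s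
            (FreeWords.prod (n + s) (FreeWords.of k (y : L)) (FreeWords.of k (x : L)))))

/-- A subspace of the space of words that is stable under all operations and contains the
defining relations. -/
structure IsEnvIdeal (X : Set L) (N : X → X → ℕ) (p : Submodule k (FreeWords k L)) : Prop where
  rel : ∀ a, EnvRel X N a → a ∈ p
  der : ∀ a ∈ p, FreeWords.der a ∈ p
  prod_left : ∀ n, ∀ a ∈ p, ∀ b, FreeWords.prod n a b ∈ p
  prod_right : ∀ n a, ∀ b ∈ p, FreeWords.prod n a b ∈ p

variable (k) in
/-- The ideal generated by the defining relations. -/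
def envIdeal (X : Set L) (N : X → X → ℕ) : Submodule k (FreeWords k L) :=
  sInf {p | IsEnvIdeal X N p}

theorem isEnvIdeal_envIdeal (X : Set L) (N : X → X → ℕ) : IsEnvIdeal X N (envIdeal k X N) where
  rel a ha := by
    simp only [envIdeal, Submodule.mem_sInf]
    exact fun p hp => hp.rel a ha
  der a ha := by
    simp only [envIdeal, Submodule.mem_sInf] at ha ⊢
    exact fun p hp => hp.der a (ha p hp)
  prod_left n a ha b := by
    simp only [envIdeal, Submodule.mem_sInf] at ha ⊢
    exact fun p hp => hp.prod_left n a (ha p hp) b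
  prod_right n a b hb := by
    simp only [envIdeal, Submodule.mem_sInf] at hb ⊢
    exact fun p hp => hp.prod_right n a b (hb p hp)

variable (k) in
/-- The universal associative envelope `U(L; X, N)` of `L` with respect to a subset `X` which
generates the `k[∂]`-module `L` and a locality bound `N` on `X`. -/
def Envelope (X : Set L) (_hX : GeneratesModule k X) (N : X → X → ℕ) : Type _ :=
  FreeWords k L ⧸ envIdeal k X N

namespace Envelope

variable {X : Set L} {hX : GeneratesModule k X} {N : X → X → ℕ}

instance : AddCommGroup (Envelope k X hX N) :=
  inferInstanceAs (AddCommGroup (FreeWords k L ⧸ envIdeal k X N))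

instance : Module k (Envelope k X hX N) :=
  inferInstanceAs (Module k (FreeWords k L ⧸ envIdeal k X N))

variable (hX N) in
/-- The class of a combination of words. -/
def mk : FreeWords k L →ₗ[k] Envelope k X hX N := (envIdeal k X N).mkQ

theorem mk_surjective : Function.Surjective (mk hX N) := (envIdeal k X N).mkQ_surjective

theorem mk_eq_zero {a : FreeWords k L} : mk hX N a = 0 ↔ a ∈ envIdeal k X N :=
  Submodule.Quotient.mk_eq_zero _

theorem mk_rel {a : FreeWords k L} (h : EnvRel X N a) : mk hX N a = 0 :=
  mk_eq_zero.2 ((isEnvIdeal_envIdeal X N).rel a h)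

def derU : Envelope k X hX N →ₗ[k] Envelope k X hX N :=
  (envIdeal k X N).mapQ (envIdeal k X N) FreeWords.der
    fun a ha => (isEnvIdeal_envIdeal X N).der a ha

def prodU (n : ℕ) :
    Envelope k X hX N →ₗ[k] Envelope k X hX N →ₗ[k] Envelope k X hX N :=
  (envIdeal k X N).liftQ
    (LinearMap.mk₂ k
      (fun a (u : Envelope k X hX N) => (envIdeal k X N).mapQ (envIdeal k X N)
        (FreeWords.prod n a) (fun b hb => (isEnvIdeal_envIdeal X N).prod_right n a b hb) u)
      (fun a a' u => by
        obtain ⟨b, rfl⟩ := (envIdeal k X N).mkQ_surjective u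
        simp
        rfl)
      (fun c a u => by
        obtain ⟨b, rfl⟩ := (envIdeal k X N).mkQ_surjective u
        simp
        rfl)
      (fun a u u' => map_add _ u u')
      (fun c a u => map_smul _ c u))
    (fun a ha => by
      rw [LinearMap.mem_ker]
      ext u
      obtain ⟨b, rfl⟩ := (envIdeal k X N).mkQ_surjective u
      exact (Submodule.Quotient.mk_eq_zero _).2
        ((isEnvIdeal_envIdeal X N).prod_left n a ha b))

theorem derU_mk (a : FreeWords k L) : derU (mk hX N a) = mk hX N (FreeWords.der a) := rfl

theorem prodU_mk (n : ℕ) (a b : FreeWords k L) :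
    prodU n (mk hX N a) (mk hX N b) = mk hX N (FreeWords.prod n a b) := rfl

/-- Induction on the construction of an element of the envelope. -/
theorem induction {P : Envelope k X hX N → Prop}
    (hof : ∀ l, P (mk hX N (FreeWords.of k l)))
    (hder : ∀ u, P u → P (derU u)) (hprod : ∀ n u w, P u → P w → P (prodU n u w))
    (hzero : P 0) (hadd : ∀ u w, P u → P w → P (u + w)) (hsmul : ∀ (c : k) u, P u → P (c • u))
    (u : Envelope k X hX N) : P u := by
  have hw : ∀ w : Word L, P (mk hX N (Finsupp.single w 1)) := by
    intro w
    induction w with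
    | of l => exact hof l
    | der a ih =>
      have := hder _ ih
      rwa [derU_mk, FreeWords.der, Finsupp.lmapDomain_apply, Finsupp.mapDomain_single] at this
    | prod n a b iha ihb =>
      have := hprod n _ _ iha ihb
      rwa [prodU_mk, FreeWords.prod, Finsupp.linearCombination_single, one_smul,
        Finsupp.lmapDomain_apply, Finsupp.mapDomain_single] at this
  obtain ⟨a, rfl⟩ := mk_surjective u
  induction a using Finsupp.induction_linear with
  | zero => simpa using hzero
  | add f g hf hg => rw [map_add]; exact hadd _ _ hf hg
  | single w c =>
    rw [← mul_one c, ← smul_eq_mul, ← Finsupp.smul_single, map_smul]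
    exact hsmul c _ (hw w)

variable (hX N) in
/-- The canonical map `ι : L → U(L; X, N)`. -/
def ι : L →ₗ[k] Envelope k X hX N where
  toFun l := mk hX N (FreeWords.of k l)
  map_add' l l' := by
    have := mk_rel (hX := hX) (EnvRel.add (k := k) (X := X) (N := N) l l')
    rw [map_sub, map_sub, sub_sub, sub_eq_zero] at this
    exact this
  map_smul' c l := by
    have := mk_rel (hX := hX) (EnvRel.smul (k := k) (X := X) (N := N) c l)
    rw [map_sub, map_smul, sub_eq_zero] at this
    exact this

theorem ι_der (l : L) : ι hX N (der (k := k) l) = derU (ι hX N l) := by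
  have := mk_rel (hX := hX) (EnvRel.der (k := k) (X := X) (N := N) l)
  rw [map_sub, sub_eq_zero] at this
  exact this

theorem prodU_der_left (n : ℕ) (u w : Envelope k X hX N) :
    prodU n (derU u) w = -((n : k) • prodU (n - 1) u w) := by
  obtain ⟨a, rfl⟩ := mk_surjective u
  obtain ⟨b, rfl⟩ := mk_surjective w
  have := mk_rel (hX := hX) (EnvRel.prod_der_left (k := k) (X := X) (N := N) n a b)
  rw [map_add, map_smul, add_eq_zero_iff_eq_neg] at this
  exact this

theorem prodU_der_right (n : ℕ) (u w : Envelope k X hX N) :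
    prodU n u (derU w) = derU (prodU n u w) + (n : k) • prodU (n - 1) u w := by
  obtain ⟨a, rfl⟩ := mk_surjective u
  obtain ⟨b, rfl⟩ := mk_surjective w
  have := mk_rel (hX := hX) (EnvRel.prod_der_right (k := k) (X := X) (N := N) n a b)
  rw [map_sub, map_sub, map_smul, sub_sub, sub_eq_zero] at this
  exact this

theorem prodU_assoc (n m : ℕ) (u w z : Envelope k X hX N) :
    prodU n u (prodU m w z) = ∑ s ∈ Finset.range (n + 1),
      (n.choose s : k) • prodU (n + m - s) (prodU s u w) z := by
  obtain ⟨a, rfl⟩ := mk_surjective u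
  obtain ⟨b, rfl⟩ := mk_surjective w
  obtain ⟨c, rfl⟩ := mk_surjective z
  have := mk_rel (hX := hX) (EnvRel.assoc (k := k) (X := X) (N := N) n m a b c)
  rw [map_sub, sub_eq_zero, map_sum] at this
  exact this

/-- If `w_(m) z = 0` for `m ≥ B` then `(u_(n) w)_(m) z = 0` for `m ≥ B`. -/
theorem local_left {w z : Envelope k X hX N} {B : ℕ} (h : ∀ m, B ≤ m → prodU m w z = 0)
    (u : Envelope k X hX N) (n m : ℕ) (hm : B ≤ m) : prodU m (prodU n u w) z = 0 := by
  induction n using Nat.strong_induction_on generalizing m with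
  | _ n ih =>
    have := prodU_assoc n m u w z
    rw [h m hm, map_zero, Finset.sum_range_succ, Finset.sum_eq_zero] at this
    · simpa using this.symm
    · intro s hs
      have hs' : s < n := by simpa using hs
      rw [ih s hs' (n + m - s) (by omega), smul_zero]

theorem exists_local (u w : Envelope k X hX N) :
    ∃ B : ℕ, ∀ n, B ≤ n → prodU n u w = 0 := by
  -- letters
  have h1 : ∀ l l' : L, ∃ B : ℕ, ∀ n, B ≤ n → prodU n (ι hX N l) (ι hX N l') = 0 := by
    have key : ∀ l, ∀ y : X, ∃ B : ℕ, ∀ n, B ≤ n → prodU n (ι hX N l) (ι hX N (y : L)) = 0 := by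
      intro l y
      let p : Submodule k L :=
        { carrier := {l | ∃ B : ℕ, ∀ n, B ≤ n → prodU n (ι hX N l) (ι hX N (y : L)) = 0}
          zero_mem' := ⟨0, by simp⟩
          add_mem' := by
            rintro a b ⟨A, hA⟩ ⟨B, hB⟩
            exact ⟨A + B, fun n hn => by simp [hA n (by omega), hB n (by omega)]⟩
          smul_mem' := by
            rintro c a ⟨A, hA⟩
            exact ⟨A, fun n hn => by simp [hA n hn]⟩ }
      have hp : p = ⊤ := hX p
        (fun x hx => ⟨N ⟨x, hx⟩ y, fun n hn => mk_rel (EnvRel.loc ⟨x, hx⟩ y n hn)⟩)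
        (by
          rintro a ⟨A, hA⟩
          refine ⟨A + 1, fun n hn => ?_⟩
          rw [ι_der, prodU_der_left, hA (n - 1) (by omega)]; simp)
      exact (hp ▸ Submodule.mem_top : l ∈ p)
    intro l l'
    let p : Submodule k L :=
      { carrier := {l' | ∃ B : ℕ, ∀ n, B ≤ n → prodU n (ι hX N l) (ι hX N l') = 0}
        zero_mem' := ⟨0, by simp⟩
        add_mem' := by
          rintro a b ⟨A, hA⟩ ⟨B, hB⟩
          exact ⟨A + B, fun n hn => by simp [hA n (by omega), hB n (by omega)]⟩
        smul_mem' := by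
          rintro c a ⟨A, hA⟩
          exact ⟨A, fun n hn => by simp [hA n hn]⟩ }
    have hp : p = ⊤ := hX p (fun x hx => key l ⟨x, hx⟩)
      (by
        rintro a ⟨A, hA⟩
        refine ⟨A + 1, fun n hn => ?_⟩
        rw [ι_der, prodU_der_right, hA n (by omega), hA (n - 1) (by omega)]; simp)
    exact (hp ▸ Submodule.mem_top : l' ∈ p)
  -- an arbitrary element and a letter
  have h2 : ∀ (u : Envelope k X hX N) (l' : L),
      ∃ B : ℕ, ∀ n, B ≤ n → prodU n u (ι hX N l') = 0 := by
    intro u l'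
    induction u using induction with
    | hof l => exact h1 l l'
    | hder u ih =>
      obtain ⟨B, hB⟩ := ih
      refine ⟨B + 1, fun n hn => ?_⟩
      rw [prodU_der_left, hB (n - 1) (by omega)]; simp
    | hprod n u w _ ihw =>
      obtain ⟨B, hB⟩ := ihw
      exact ⟨B, fun m hm => local_left hB u n m hm⟩
    | hzero => exact ⟨0, by simp⟩
    | hadd u w ihu ihw =>
      obtain ⟨A, hA⟩ := ihu
      obtain ⟨B, hB⟩ := ihw
      exact ⟨A + B, fun n hn => by simp [hA n (by omega), hB n (by omega)]⟩
    | hsmul c u ih =>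
      obtain ⟨A, hA⟩ := ih
      exact ⟨A, fun n hn => by simp [hA n hn]⟩
  induction w using induction generalizing u with
  | hof l => exact h2 u l
  | hder w ih =>
    obtain ⟨B, hB⟩ := ih u
    refine ⟨B + 1, fun n hn => ?_⟩
    rw [prodU_der_right, hB n (by omega), hB (n - 1) (by omega)]; simp
  | hprod m w z ihw ihz =>
    obtain ⟨A, hA⟩ := ihw u
    obtain ⟨B, hB⟩ := ihz w
    refine ⟨A + B, fun n hn => ?_⟩
    rw [prodU_assoc]
    refine Finset.sum_eq_zero fun s hs => ?_
    have hs' : s < n + 1 := by simpa using hs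
    rcases le_or_gt A s with h | h
    · rw [hA s h]; simp
    · rw [local_left hB u s (n + m - s) (by omega), smul_zero]
  | hzero => exact ⟨0, by simp⟩
  | hadd w z ihw ihz =>
    obtain ⟨A, hA⟩ := ihw u
    obtain ⟨B, hB⟩ := ihz u
    exact ⟨A + B, fun n hn => by simp [hA n (by omega), hB n (by omega)]⟩
  | hsmul c w ih =>
    obtain ⟨A, hA⟩ := ih u
    exact ⟨A, fun n hn => by simp [hA n hn]⟩

instance : ConformalAlgebra k (Envelope k X hX N) where
  der := derU
  prod := prodU
  locality := exists_local
  prod_der_left := prodU_der_left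
  prod_der_right := prodU_der_right

instance : IsAssociative k (Envelope k X hX N) := ⟨prodU_assoc⟩

/-- `U(L; X, N)` is an associative envelope of `L` with locality bounded by `N` on `X`. -/
theorem isEnvelope [CharZero k] : IsEnvelope X N (ι hX N) where
  associative := inferInstance
  hom := by
    refine ⟨ι_der, ?_⟩
    have key : ∀ l (y : X) n, ι hX N (prod (k := k) n l (y : L)) =
        prod (k := k) n (ι hX N l) (ι hX N (y : L)) - curly k n (ι hX N (y : L)) (ι hX N l) := by
      intro l y
      let p : Submodule k L :=
        { carrier := {l | ∀ n, ι hX N (prod (k := k) n l (y : L)) =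
            prod (k := k) n (ι hX N l) (ι hX N (y : L)) - curly k n (ι hX N (y : L)) (ι hX N l)}
          zero_mem' := fun n => by
            have := curly_smul_right (k := k) n 0 (ι hX N (y : L)) 0
            simp only [smul_zero, zero_smul] at this
            simp [this]
          add_mem' := fun {a b} ha hb n => by
            rw [map_add, LinearMap.add_apply, map_add, ha n, hb n, map_add, map_add,
              LinearMap.add_apply, curly_add_right]
            abel
          smul_mem' := fun c a ha n => by
            rw [map_smul, LinearMap.smul_apply, map_smul, ha n, map_smul, map_smul,
              LinearMap.smul_apply, curly_smul_right, smul_sub] }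
      have hp : p = ⊤ := by
        refine hX p (fun x hx n => ?_) (fun a ha n => ?_)
        · have hloc : ∀ m, N y ⟨x, hx⟩ ≤ m →
              prod (k := k) m (ι hX N (y : L)) (ι hX N x) = 0 :=
            fun m hm => mk_rel (EnvRel.loc y ⟨x, hx⟩ m hm)
          have h := mk_rel (hX := hX)
            (EnvRel.comm (k := k) (X := X) (N := N) ⟨x, hx⟩ y n)
          rw [curly_eq_sum hloc n (N y ⟨x, hx⟩ - n) (by omega)]
          rw [map_sub, sub_eq_zero, map_sub, map_sum] at h
          refine h.trans ?_
          congr 1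
          refine Finset.sum_congr rfl fun s _ => ?_
          have hpow : ∀ (t : ℕ) (a : FreeWords k L),
              mk hX N ((FreeWords.der ^ t) a) = (der (k := k) ^ t) (mk hX N a) := by
            intro t a
            induction t with
            | zero => rfl
            | succ t ih =>
              rw [pow_succ', pow_succ', Module.End.mul_apply, Module.End.mul_apply, ← ih]
              rfl
          rw [map_smul, FreeWords.divDer, LinearMap.smul_apply, map_smul, hpow]
          rfl
        · have e : ι hX N (der (k := k) a) = der (k := k) (ι hX N a) := ι_der a
          rw [prod_der_left, map_neg, map_smul, ha (n - 1), e, prod_der_left, curly_der_right,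
            smul_sub]
          abel
      exact fun n => (hp ▸ Submodule.mem_top : l ∈ p) n
    intro n l l'
    let p : Submodule k L :=
      { carrier := {l' | ∀ n, ι hX N (prod (k := k) n l l') =
          prod (k := k) n (ι hX N l) (ι hX N l') - curly k n (ι hX N l') (ι hX N l)}
        zero_mem' := fun n => by
          have := curly_smul_left (k := k) n 0 0 (ι hX N l)
          simp only [smul_zero, zero_smul] at this
          simp [this]
        add_mem' := fun {a b} ha hb n => by
          rw [map_add, map_add, ha n, hb n, map_add, map_add, curly_add_left]
          abel
        smul_mem' := fun c a ha n => by
          rw [map_smul, map_smul, ha n, map_smul, map_smul, curly_smul_left, smul_sub] }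
    have hp : p = ⊤ := by
      refine hX p (fun x hx n => key l ⟨x, hx⟩ n) (fun a ha n => ?_)
      have e : ι hX N (der (k := k) a) = der (k := k) (ι hX N a) := ι_der a
      rw [prod_der_right, map_add, map_smul, ha (n - 1), e, prod_der_right, curly_der_left,
        smul_sub, show ι hX N (der (k := k) (prod (k := k) n l a)) = der (k := k) _ from ι_der _,
        ha n, map_sub]
      abel
    exact (hp ▸ Submodule.mem_top : l' ∈ p) n
  generates := fun p hp hder hprod => by
    refine Submodule.eq_top_iff'.2 fun u => ?_
    induction u using induction with
    | hof l => exact hp ⟨l, rfl⟩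
    | hder u ih => exact hder u ih
    | hprod n u w ihu ihw => exact hprod n u ihu w ihw
    | hzero => exact p.zero_mem
    | hadd u w ihu ihw => exact p.add_mem ihu ihw
    | hsmul c u ih => exact p.smul_mem c ih
  local_le := fun x y n h => mk_rel (EnvRel.loc x y n h)

/-- The value of a word in an envelope. -/
def evalWord (φ : L →ₗ[k] C) : Word L → C
  | .of l => φ l
  | .der a => der (k := k) (evalWord φ a)
  | .prod n a b => prod (k := k) n (evalWord φ a) (evalWord φ b)

/-- The universal property: every associative envelope of `L` with locality bounded by `N` on `X`
receives a unique homomorphism from `U(L; X, N)` which is compatible with the maps from `L`. -/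
theorem universal {φ : L →ₗ[k] C} (hφ : IsEnvelope X N φ) :
    ∃! f : Envelope k X hX N →ₗ[k] C, IsHom f ∧ ∀ l, f (ι hX N l) = φ l := by
  let g : FreeWords k L →ₗ[k] C := Finsupp.linearCombination k (evalWord φ)
  have gof : ∀ l, g (FreeWords.of k l) = φ l := fun l => by
    simp [g, FreeWords.of, evalWord]
  have gder : ∀ a, g (FreeWords.der a) = der (k := k) (g a) := by
    intro a
    induction a using Finsupp.induction_linear with
    | zero => simp
    | add f h hf hh => simp only [map_add, hf, hh]
    | single w c => simp [g, FreeWords.der, evalWord]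
  have gprod : ∀ n a b, g (FreeWords.prod n a b) = prod (k := k) n (g a) (g b) := by
    intro n a b
    induction a using Finsupp.induction_linear with
    | zero => simp
    | add f h hf hh => simp only [map_add, LinearMap.add_apply, hf, hh]
    | single w c =>
      induction b using Finsupp.induction_linear with
      | zero => simp
      | add f h hf hh => simp only [map_add, hf, hh]
      | single w' c' =>
        have e : FreeWords.prod n (Finsupp.single w c) (Finsupp.single w' c') =
            Finsupp.single (Word.prod n w w') (c * c') := by
          simp [FreeWords.prod, Finsupp.linearCombination_single]
        rw [e]
        simp only [g, Finsupp.linearCombination_single, evalWord, map_smul, LinearMap.smul_apply,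
          smul_smul]
        rw [mul_comm c c']
  have gdiv : ∀ s a, g (FreeWords.divDer s a) = divDer k s (g a) := by
    intro s a
    simp only [FreeWords.divDer, divDer, LinearMap.smul_apply, map_smul]
    congr 1
    induction s with
    | zero => rfl
    | succ t ih => rw [pow_succ', pow_succ', Module.End.mul_apply, Module.End.mul_apply,
        gder, ih]
  have hideal : IsEnvIdeal X N (LinearMap.ker g) :=
    { rel := by
        intro a ha
        rw [LinearMap.mem_ker]
        cases ha with
        | add l l' => simp [gof]
        | smul c l => simp [gof]
        | der l => simp [gof, gder, hφ.hom.map_der]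
        | prod_der_left n a b => simp [gprod, gder, prod_der_left]
        | prod_der_right n a b => simp [gprod, gder, prod_der_right]
        | assoc n m a b c =>
          simp only [map_sub, map_sum, map_smul, gprod, hφ.associative.assoc, sub_self]
        | loc x y n h => rw [gprod, gof, gof, hφ.local_le x y n h]
        | comm x y n =>
          simp only [map_sub, map_sum, map_smul, gprod, gdiv, gof, hφ.hom.map_prod]
          rw [curly_eq_sum (hφ.local_le y x) n (N y x - n) (by omega), sub_self]
      der := fun a ha => by
        rw [LinearMap.mem_ker] at ha ⊢
        rw [gder, ha, map_zero]
      prod_left := fun n a ha b => by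
        rw [LinearMap.mem_ker] at ha ⊢
        rw [gprod, ha, map_zero, LinearMap.zero_apply]
      prod_right := fun n a b hb => by
        rw [LinearMap.mem_ker] at hb ⊢
        rw [gprod, hb, map_zero] }
  obtain ⟨F, hF⟩ : ∃ F : Envelope k X hX N →ₗ[k] C, ∀ a, F (mk hX N a) = g a :=
    ⟨(envIdeal k X N).liftQ g (sInf_le hideal), fun _ => rfl⟩
  have Fder : ∀ u, F (der (k := k) u) = der (k := k) (F u) := by
    intro u
    obtain ⟨a, rfl⟩ := mk_surjective u
    rw [hF, ← gder, ← hF]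
    rfl
  have Fprod : ∀ n u w, F (prod (k := k) n u w) = prod (k := k) n (F u) (F w) := by
    intro n u w
    obtain ⟨a, rfl⟩ := mk_surjective u
    obtain ⟨b, rfl⟩ := mk_surjective w
    rw [hF, hF, ← gprod, ← hF]
    rfl
  have Fι : ∀ l, F (ι hX N l) = φ l := fun l => (hF _).trans (gof l)
  refine ⟨F, ⟨⟨Fder, Fprod⟩, Fι⟩, ?_⟩
  · rintro f ⟨hf, hfι⟩
    ext u
    induction u using induction with
    | hof l => exact (hfι l).trans (Fι l).symm
    | hder u ih => exact (hf.map_der u).trans (by rw [ih, ← Fder]; rfl)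
    | hprod n u w ihu ihw => exact (hf.map_prod n u w).trans (by rw [ihu, ihw, ← Fprod]; rfl)
    | hzero => rw [map_zero, map_zero]
    | hadd u w ihu ihw => rw [map_add, map_add, ihu, ihw]
    | hsmul c u ih => rw [map_smul, map_smul, ih]

end Envelope

end Envelopes

section Virasoro

variable (k : Type*) [Field k]

/-- The underlying space of the Virasoro conformal algebra: the free `k[∂]`-module `k[∂]v` of
rank one, where `f(∂)v` is the polynomial `f`. -/
abbrev Vir : Type _ := k[X]

namespace Vir

/-- The generator. -/
def v : Vir k := (1 : k[X])

variable {k}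

/-- `[f(∂)v_λ g(∂)v] = f(-λ) g(∂+λ) (∂ + 2λ) v`; the outer variable is `λ`, the inner one is `∂`. -/
def lambdaBracket (f g : k[X]) : k[X][X] :=
  aeval (-X : k[X][X]) f * aeval (C X + X : k[X][X]) g * (C X + 2 * X)

/-- `∂` acts by multiplication by the variable. -/
def derV : Vir k →ₗ[k] Vir k := LinearMap.mulLeft k (X : k[X])

/-- The `n`-th product is the coefficient of `λ^n / n!` in the `λ`-bracket. -/
def prodV (n : ℕ) : Vir k →ₗ[k] Vir k →ₗ[k] Vir k :=
  LinearMap.mk₂ k (fun f g : k[X] => ((n.factorial : k) • (lambdaBracket f g).coeff n : k[X]))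
    (fun f f' g => by simp [lambdaBracket, add_mul])
    (fun c f g => by simp [lambdaBracket, smul_comm c])
    (fun f g g' => by
      simp only [lambdaBracket, map_add, mul_add (aeval _ f), add_mul _ _ (C X + 2 * X), coeff_add,
        smul_add])
    (fun c f g => by simp [lambdaBracket, smul_comm c])

theorem prodV_apply (n : ℕ) (f g : k[X]) :
    prodV n (f : Vir k) (g : Vir k) = ((n.factorial : k) • (lambdaBracket f g).coeff n : k[X]) :=
  rfl

theorem derV_apply (f : k[X]) : derV f = X * f := rfl

theorem lambdaBracket_X_mul_left (f g : k[X]) :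
    lambdaBracket (X * f) g = -(X * lambdaBracket f g) := by
  simp only [lambdaBracket, map_mul, aeval_X]
  ring

theorem lambdaBracket_X_mul_right (f g : k[X]) :
    lambdaBracket f (X * g) = C X * lambdaBracket f g + X * lambdaBracket f g := by
  simp only [lambdaBracket, map_mul, aeval_X]
  ring

theorem prodV_local (f g : k[X]) : ∃ N : ℕ, ∀ n, N ≤ n → prodV n f g = 0 :=
  ⟨(lambdaBracket f g).natDegree + 1, fun n hn => by
    rw [prodV_apply, coeff_eq_zero_of_natDegree_lt (by omega), smul_zero]⟩

theorem prodV_der_left (n : ℕ) (f g : k[X]) :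
    prodV n (derV f) g = -((n : k) • prodV (n - 1) f g) := by
  rw [derV_apply, prodV_apply, prodV_apply, lambdaBracket_X_mul_left]
  cases n with
  | zero => simp
  | succ n =>
    rw [coeff_neg, coeff_X_mul, smul_neg, smul_smul, Nat.factorial_succ, Nat.cast_mul,
      Nat.add_sub_cancel]

theorem prodV_der_right (n : ℕ) (f g : k[X]) :
    prodV n f (derV g) = derV (prodV n f g) + (n : k) • prodV (n - 1) f g := by
  rw [derV_apply, derV_apply, prodV_apply, prodV_apply, prodV_apply, lambdaBracket_X_mul_right,
    coeff_add, coeff_C_mul, smul_add, mul_smul_comm]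
  congr 1
  cases n with
  | zero => simp
  | succ n =>
    rw [coeff_X_mul, smul_smul, Nat.factorial_succ, Nat.cast_mul, Nat.add_sub_cancel]

instance : ConformalAlgebra k (Vir k) where
  der := derV
  prod := prodV
  locality := prodV_local
  prod_der_left := prodV_der_left
  prod_der_right := prodV_der_right

/-- `[v_λ v] = (∂ + 2λ)v`. -/
theorem prod_v_v (n : ℕ) : prod (k := k) n (v k) (v k) =
    if n = 0 then der (k := k) (v k) else if n = 1 then (2 : k) • v k else 0 := by
  change prodV n (1 : k[X]) 1 = if n = 0 then derV (1 : k[X]) else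
    if n = 1 then ((2 : k) • (1 : k[X])) else 0
  rw [prodV_apply, derV_apply]
  have h : lambdaBracket (1 : k[X]) 1 = C X + C 2 * X := by
    simp only [lambdaBracket, map_one, one_mul, map_ofNat]
  rw [h, coeff_add, coeff_C, coeff_C_mul, coeff_X]
  rcases n with _ | _ | n
  · simp
  · simp [smul_eq_C_mul, map_ofNat]
  · simp

variable (k) in
/-- `v` generates `Vir` as a `k[∂]`-module. -/
theorem generatesModule : GeneratesModule k ({v k} : Set (Vir k)) := by
  intro p hv hder
  refine Submodule.eq_top_iff'.2 fun f => ?_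
  have hpow : ∀ n : ℕ, (((X : k[X]) ^ n : k[X]) : Vir k) ∈ p := by
    intro n
    induction n with
    | zero => exact (pow_zero (X : k[X])).symm ▸ hv rfl
    | succ n ih => exact (pow_succ' (X : k[X]) n).symm ▸ hder _ ih
  change k[X] at f
  induction f using Polynomial.induction_on' with
  | add f g hf hg => exact p.add_mem hf hg
  | monomial n a =>
    rw [← C_mul_X_pow_eq_monomial, ← smul_eq_C_mul]
    exact p.smul_mem a (hpow n)

/-- Induction principle for `Vir`. -/
theorem induction {P : Vir k → Prop} (hv : P (v k)) (hadd : ∀ x y, P x → P y → P (x + y))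
    (hsmul : ∀ (c : k) x, P x → P (c • x)) (hder : ∀ x, P x → P (der (k := k) x))
    (x : Vir k) : P x := by
  let p : Submodule k (Vir k) :=
    { carrier := {x | P x}
      zero_mem' := by simpa using hsmul 0 _ hv
      add_mem' := fun {a b} ha hb => hadd a b ha hb
      smul_mem' := fun c a ha => hsmul c a ha }
  have hp : p = ⊤ := generatesModule k p (by rintro _ rfl; exact hv) hder
  exact (hp ▸ Submodule.mem_top : x ∈ p)

theorem anticomm [CharZero k] (x y : Vir k) :
    ∀ n, prod (k := k) n x y = -curly k n y x := by
  induction x using induction with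
  | hadd x x' hx hx' => intro n; rw [map_add, LinearMap.add_apply, hx, hx', curly_add_right]; abel
  | hsmul c x hx => intro n; rw [map_smul, LinearMap.smul_apply, hx, curly_smul_right, smul_neg]
  | hder x hx => intro n; rw [prod_der_left, hx, curly_der_right, smul_neg]
  | hv =>
    induction y using induction with
    | hadd x x' hx hx' => intro n; rw [map_add, hx, hx', curly_add_left]; abel
    | hsmul c x hx => intro n; rw [map_smul, hx, curly_smul_left, smul_neg]
    | hder x hx =>
      intro n; rw [prod_der_right, hx, hx, curly_der_left, smul_neg, map_neg]; abel
    | hv =>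
      intro n
      have hloc : ∀ m, 2 ≤ m → prod (k := k) m (v k) (v k) = 0 := fun m hm => by
        rw [prod_v_v, if_neg (by omega), if_neg (by omega)]
      rw [curly_eq_sum hloc n 2 (by omega)]
      rcases n with _ | _ | n
      · simp [Finset.sum_range_succ, prod_v_v, divDer]
        module
      · simp [Finset.sum_range_succ, prod_v_v, divDer]
      · rw [hloc _ (by omega), Finset.sum_eq_zero, neg_zero]
        intro s _
        rw [hloc _ (by omega), map_zero, smul_zero]

theorem jacobi (x y z : Vir k) : ∀ n m,
    prod (k := k) n x (prod (k := k) m y z) - prod (k := k) m y (prod (k := k) n x z) =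
      nested (k := k) n m x y z := by
  induction x using induction with
  | hadd x x' hx hx' =>
    intro n m
    rw [nested_add_left, ← hx, ← hx']
    simp only [map_add, LinearMap.add_apply]
    abel
  | hsmul c x hx =>
    intro n m
    rw [nested_smul_left, ← hx]
    simp only [map_smul, LinearMap.smul_apply, smul_sub]
  | hder x hx =>
    intro n m
    rw [nested_der_left, ← hx]
    simp only [prod_der_left, map_smul, map_neg, smul_sub]
    abel
  | hv =>
    induction y using induction with
    | hadd x x' hx hx' =>
      intro n m
      rw [nested_add_mid, ← hx, ← hx']
      simp only [map_add, LinearMap.add_apply]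
      abel
    | hsmul c x hx =>
      intro n m
      rw [nested_smul_mid, ← hx]
      simp only [map_smul, LinearMap.smul_apply, smul_sub]
    | hder x hx =>
      intro n m
      rw [nested_der_mid, ← hx]
      simp only [prod_der_left, map_smul, map_neg, smul_sub]
      abel
    | hv =>
      induction z using induction with
      | hadd x x' hx hx' =>
        intro n m
        rw [nested_add_right, ← hx, ← hx']
        simp only [map_add]
        abel
      | hsmul c x hx =>
        intro n m
        rw [nested_smul_right, ← hx]
        simp only [map_smul, smul_sub]
      | hder x hx =>
        intro n m
        rw [nested_der_right, ← hx, ← hx, ← hx]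
        simp only [prod_der_right, map_smul, map_add, map_sub, smul_sub]
        abel
      | hv =>
        intro n m
        have hloc : ∀ m, 2 ≤ m → prod (k := k) m (v k) (v k) = 0 := fun m hm => by
          rw [prod_v_v, if_neg (by omega), if_neg (by omega)]
        have h0 : prod (k := k) 0 (v k) (v k) = der (k := k) (v k) := by simp [prod_v_v]
        have h1 : prod (k := k) 1 (v k) (v k) = (2 : k) • v k := by simp [prod_v_v]
        have hR : nested (k := k) n m (v k) (v k) (v k) =
            ((n : k) - (m : k)) • prod (k := k) (n + m - 1) (v k) (v k) := by
          rw [nested]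
          rcases n with _ | n
          · simp [h0, prod_der_left]
          · rw [Finset.sum_range_succ', Finset.sum_range_succ', Finset.sum_eq_zero]
            · simp only [zero_add, h0, h1, prod_der_left, Nat.choose_zero_right, Nat.choose_one_right,
                map_smul, LinearMap.smul_apply, Nat.sub_zero]
              push_cast
              module
            · intro s _
              rw [hloc (s + 1 + 1) (by omega)]
              simp
        rw [hR]
        have key : ∀ n m, prod (k := k) n (v k) (prod (k := k) m (v k) (v k)) =
            if m = 0 then der (k := k) (prod (k := k) n (v k) (v k)) +
              (n : k) • prod (k := k) (n - 1) (v k) (v k)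
            else if m = 1 then (2 : k) • prod (k := k) n (v k) (v k) else 0 := by
          intro n m
          rcases m with _ | _ | m
          · rw [h0, prod_der_right]; simp
          · rw [show 0 + 1 = 1 from rfl, h1, map_smul]; simp
          · rw [hloc (m + 1 + 1) (by omega)]; simp
        rw [key n m, key m n]
        rcases n with _ | _ | n <;> rcases m with _ | _ | m
        · simp
        · simp [h0, h1]
        · simp [hloc]; module
        · simp [h0, h1]
        · simp
        · simp [hloc]
        · simp [hloc]
        · simp [hloc]
        · rw [hloc (n + 1 + 1 + (m + 1 + 1) - 1) (by omega)]; simp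

instance [CharZero k] : IsLie k (Vir k) where
  anticomm n x y := anticomm x y n
  jacobi n m x y z := jacobi x y z n m

variable (k)

/-- `U(Vir; v, N)`: the universal associative envelope of `Vir` with locality bound `N`
on the generator `v`. -/
abbrev VirEnvelope (N : ℕ) : Type _ :=
  Envelope k ({v k} : Set (Vir k)) (generatesModule k) (fun _ _ => N)

/-- The image of the generator `v` in `U(Vir; v, N)`. -/
def vU (N : ℕ) : VirEnvelope k N := Envelope.ι (generatesModule k) _ (v k)

/-- The operator `L_n = (v_(n) ·)` on `U(Vir; v, N)`. -/
def Lop (N n : ℕ) : VirEnvelope k N →ₗ[k] VirEnvelope k N := prod n (vU k N)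

end Vir

end Virasoro

end ConformalAlgebra

end

open ConformalAlgebra

/-! Write `e = L_2 v`. The proof has two independent halves: the listed elements span, and they are
independent because they remain so in a concrete associative conformal algebra.

Spanning. The commutator identity at `n = 1` reads `2v = 2 L_1 v - ∂e`, that is `L_1 v = v + ∂e/2`
(`Lop_one_vU`). Associativity expresses `L_n L_m` through the products with `v_(0) v`, `v_(1) v` and
`e`; eliminating `v_(1) v` gives `[L_n, L_0] = n L_(n-1)` and `[L_n, L_1] = (n-1) L_n`. Locality
also forces `L_n e = 0` for `n ≥ 2` (`Lop_Lop_two_vU`). Hence a subspace that contains `v` and `e`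
and is stable under `∂`, `L_0`, `L_1` is everything (`eq_top_of_stable_zero_one`), and both spans
are stable, by moving the operators past each other.

Independence. If `A` is commutative with a locally nilpotent derivation `d`, then `A[∂]` with `f_λ g
= f(-λ) e^{λD} g`, where `D` extends `d` by `D∂ = 1`, is an associative conformal algebra. Take `A =
k[Δ][x]` and `d = d/dx`. The element `x - Δ∂` has locality `3` with itself and satisfies the
Virasoro relations, so `v ↦ x - Δ∂` extends to the envelope. There `L_0` is multiplication by `x`,
`L_1 = xD + Δ`, and `e` becomes `2Δ(1 - Δ)`. Keeping the weight `Δ` as a variable is what separates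
the powers of `L_1`. The images are explicit polynomials, and picking one monomial from each makes
the families triangular (`linearIndependent_model`, `linearIndependent_model_der`). -/

/-- The Leibniz rule for the powers of a derivation. -/
theorem Derivation.pow_apply_mul {k B : Type*} [Field k] [CommRing B] [Algebra k B]
    (D : Derivation k B B) (n : ℕ) (a b : B) :
    ((D : B →ₗ[k] B) ^ n) (a * b) = ∑ s ∈ Finset.range (n + 1),
      (n.choose s : k) • (((D : B →ₗ[k] B) ^ s) a * ((D : B →ₗ[k] B) ^ (n - s)) b) := by
  -- The statement over `range` has the shape of the associativity axiom; the induction is run over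
  -- the antidiagonal, where Pascal's rule is available.
  rw [← Finset.Nat.sum_antidiagonal_eq_sum_range_succ
    (fun i j => (n.choose i : k) • (((D : B →ₗ[k] B) ^ i) a * ((D : B →ₗ[k] B) ^ j) b)) n]
  simp only [Nat.cast_smul_eq_nsmul]
  induction n with
  | zero => simp
  | succ n ih =>
    rw [Finset.sum_antidiagonal_choose_succ_nsmul
      (fun i j => ((D : B →ₗ[k] B) ^ i) a * ((D : B →ₗ[k] B) ^ j) b) n, pow_succ',
      Module.End.mul_apply, ih, map_sum, ← Finset.sum_add_distrib]
    refine Finset.sum_congr rfl fun ij hij => ?_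
    rw [n.choose_symm_of_eq_add (Finset.HasAntidiagonal.mem_antidiagonal.1 hij).symm, ← nsmul_add,
      map_nsmul]
    simp only [pow_succ', Module.End.mul_apply, Derivation.coeFn_coe, Derivation.leibniz,
      smul_eq_mul]
    ring

/-! ### The associative conformal algebra of differential polynomials -/

namespace Polynomial

variable {k : Type*} [Field k] {A : Type*} [CommRing A] [Algebra k A]

/-- The derivation of `A[X]` that extends the derivation `d` of `A` and sends `X` to `1`. -/
noncomputable def extendDer (d : Derivation k A A) : Derivation k A[X] A[X] :=
  ((PolynomialModule.equivPolynomialSelf (R := A)).toLinearMap.restrictScalars A[X]).compDer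
    d.mapCoeffs + (derivative' (R := A)).restrictScalars k

theorem extendDer_X (d : Derivation k A A) : extendDer d X = 1 := by
  simp [extendDer]

theorem extendDer_C (d : Derivation k A A) (a : A) : extendDer d (C a) = C (d a) := by
  simp [extendDer]

theorem extendDer_pow_C (d : Derivation k A A) (n : ℕ) (a : A) :
    ((extendDer d : A[X] →ₗ[k] A[X]) ^ n) (C a) = C (((d : A →ₗ[k] A) ^ n) a) := by
  induction n with
  | zero => simp
  | succ n ih => simp [pow_succ', ih, extendDer_C]

/-- From `D X = 1` follows the Heisenberg relation `[D, X] = 1`, hence `[D^n, X] = n D^(n-1)`. The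
truncation of `n - 1` at `n = 0` is harmless because of the factor `n`. -/
theorem extendDer_pow_X_mul (d : Derivation k A A) (n : ℕ) (f : A[X]) :
    ((extendDer d : A[X] →ₗ[k] A[X]) ^ n) (X * f) =
      X * ((extendDer d : A[X] →ₗ[k] A[X]) ^ n) f +
        (n : k) • ((extendDer d : A[X] →ₗ[k] A[X]) ^ (n - 1)) f := by
  induction n with
  | zero => simp
  | succ n ih =>
    rw [pow_succ', Module.End.mul_apply, ih, map_add, map_smul, Derivation.coeFn_coe,
      Derivation.leibniz, extendDer_X, smul_eq_mul, smul_eq_mul, mul_one, ← Derivation.coeFn_coe,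
      ← Module.End.mul_apply, ← pow_succ', Nat.add_sub_cancel, ← Module.End.mul_apply,
      ← pow_succ']
    rcases n with _ | n
    · simp
    · rw [Nat.add_sub_cancel]
      push_cast
      module

/-- The `n`-th product `f_(n) g`, the coefficient of `λ^n / n!` in `f(-λ) e^{λD} g`, where `D`
extends the derivation `d` of the coefficients. -/
noncomputable def diffProd (d : Derivation k A A) (n : ℕ) : A[X] →ₗ[k] A[X] →ₗ[k] A[X] :=
  LinearMap.mk₂ k (fun f g => ∑ i ∈ Finset.range (n + 1),
      ((-1 : k) ^ i * (n.descFactorial i : k)) •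
        (C (f.coeff i) * ((extendDer d : A[X] →ₗ[k] A[X]) ^ (n - i)) g))
    (fun f f' g => by simp [add_mul, Finset.sum_add_distrib])
    (fun c f g => by
      simp only [coeff_smul, ← smul_C, smul_mul_assoc, Finset.smul_sum, smul_comm c])
    (fun f g g' => by simp [mul_add, Finset.sum_add_distrib])
    (fun c f g => by simp only [map_smul, mul_smul_comm, Finset.smul_sum, smul_comm c])

theorem diffProd_apply (d : Derivation k A A) (n : ℕ) (f g : A[X]) :
    diffProd d n f g = ∑ i ∈ Finset.range (n + 1), ((-1 : k) ^ i * (n.descFactorial i : k)) •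
      (C (f.coeff i) * ((extendDer d : A[X] →ₗ[k] A[X]) ^ (n - i)) g) := rfl

/-- Only the term `i = 0` survives: a coefficient `a` acts as `a e^{λD}`. Together with
sesquilinearity this determines the product. -/
theorem diffProd_C_left (d : Derivation k A A) (n : ℕ) (a : A) (g : A[X]) :
    diffProd d n (C a) g = C a * ((extendDer d : A[X] →ₗ[k] A[X]) ^ n) g := by
  rw [diffProd_apply, Finset.sum_range_succ', Finset.sum_eq_zero]
  · simp
  · intro i _
    simp

/-- In `f(-λ)` the variable becomes `-λ`, and a factor `λ` turns the coefficient of `λ^n/n!` into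
`n` times the one of index `n - 1`. -/
theorem diffProd_X_mul_left (d : Derivation k A A) (n : ℕ) (f g : A[X]) :
    diffProd d n (X * f) g = -((n : k) • diffProd d (n - 1) f g) := by
  rw [diffProd_apply, Finset.sum_range_succ', diffProd_apply]
  rcases n with _ | n
  · simp
  · rw [Nat.add_sub_cancel, Finset.smul_sum, ← Finset.sum_neg_distrib]
    simp only [coeff_X_mul, mul_coeff_zero, coeff_X_zero, zero_mul, map_zero, smul_zero, add_zero]
    refine Finset.sum_congr rfl fun i _ => ?_
    rw [Nat.succ_descFactorial_succ, Nat.add_sub_add_right, smul_smul, ← neg_smul]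
    congr 1
    push_cast
    ring

/-- This is the coefficient form of `e^{λD} X = (X + λ) e^{λD}`. -/
theorem diffProd_X_mul_right (d : Derivation k A A) (n : ℕ) (f g : A[X]) :
    diffProd d n f (X * g) = X * diffProd d n f g + (n : k) • diffProd d (n - 1) f g := by
  -- The correction term is put over the same range with the factor `n - i` produced by commuting
  -- `D^(n-i)` past `X`. The term `i = n` vanishes, and the others match by `n (n-1)_i = (n-i)
  -- (n)_i` for falling factorials.
  have h : (n : k) • diffProd d (n - 1) f g = ∑ i ∈ Finset.range (n + 1),
      ((-1 : k) ^ i * (n.descFactorial i : k)) •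
      (C (f.coeff i) * (((n - i : ℕ) : k) •
        ((extendDer d : A[X] →ₗ[k] A[X]) ^ (n - i - 1)) g)) := by
    rcases n with _ | n
    · simp
    · rw [Finset.sum_range_succ, diffProd_apply, Nat.add_sub_cancel, Finset.smul_sum]
      simp only [Nat.sub_self, Nat.cast_zero, zero_smul, mul_zero, smul_zero, add_zero]
      refine Finset.sum_congr rfl fun i hi => ?_
      have hi : i ≤ n := by simpa [Nat.lt_succ_iff] using hi
      rw [mul_smul_comm, smul_smul, smul_smul, show n + 1 - i - 1 = n - i by omega]
      congr 1
      have := congrArg (Nat.cast : ℕ → k) (Nat.succ_descFactorial n i)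
      push_cast at this ⊢
      linear_combination -(-1) ^ i * this
  rw [h, diffProd_apply, diffProd_apply, Finset.mul_sum, ← Finset.sum_add_distrib]
  refine Finset.sum_congr rfl fun i _ => ?_
  rw [extendDer_pow_X_mul, mul_add, smul_add, mul_smul_comm, mul_smul_comm, mul_left_comm]

/-- Multiplication by `X` is the action of `∂`, so this induction reduces sesquilinear statements to
constant polynomials. -/
theorem induction_X_mul {P : A[X] → Prop} (hC : ∀ a, P (C a)) (hX : ∀ f, P f → P (X * f))
    (hadd : ∀ f g, P f → P g → P (f + g)) (f : A[X]) : P f := by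
  induction f using Polynomial.induction_on with
  | C a => exact hC a
  | add f g hf hg => exact hadd f g hf hg
  | monomial n a h =>
    convert hX _ h using 1
    rw [pow_succ']
    ring

/-- Local nilpotency passes from `d` to `D`: each factor `X` costs at most one more power of `D`.
Then `f` is handled by sesquilinearity. -/
theorem diffProd_local (d : Derivation k A A)
    (hd : ∀ a, ∃ N : ℕ, ∀ n, N ≤ n → ((d : A →ₗ[k] A) ^ n) a = 0) (f g : A[X]) :
    ∃ N : ℕ, ∀ n, N ≤ n → diffProd d n f g = 0 := by
  have hD : ∃ N : ℕ, ∀ n, N ≤ n → ((extendDer d : A[X] →ₗ[k] A[X]) ^ n) g = 0 := by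
    induction g using induction_X_mul with
    | hC a =>
      obtain ⟨N, hN⟩ := hd a
      exact ⟨N, fun n hn => by rw [extendDer_pow_C, hN n hn, C_0]⟩
    | hX f h =>
      obtain ⟨N, hN⟩ := h
      exact ⟨N + 1, fun n hn => by
        rw [extendDer_pow_X_mul, hN n (by omega), hN (n - 1) (by omega)]; simp⟩
    | hadd f g hf hg =>
      obtain ⟨N, hN⟩ := hf
      obtain ⟨M, hM⟩ := hg
      exact ⟨N + M, fun n hn => by rw [map_add, hN n (by omega), hM n (by omega), add_zero]⟩
  obtain ⟨N, hN⟩ := hD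
  induction f using induction_X_mul with
  | hC a => exact ⟨N, fun n hn => by rw [diffProd_C_left, hN n hn, mul_zero]⟩
  | hX f h =>
    obtain ⟨M, hM⟩ := h
    exact ⟨M + 1, fun n hn => by rw [diffProd_X_mul_left, hM (n - 1) (by omega)]; simp⟩
  | hadd f f' hf hg =>
    obtain ⟨N, hN⟩ := hf
    obtain ⟨M, hM⟩ := hg
    exact ⟨N + M, fun n hn => by
      rw [map_add, LinearMap.add_apply, hN n (by omega), hM n (by omega), add_zero]⟩

/-- The conformal algebra of differential polynomials over an algebra with a locally nilpotent
derivation. -/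
@[reducible]
noncomputable def diffConformal (d : Derivation k A A)
    (hd : ∀ a, ∃ N : ℕ, ∀ n, N ≤ n → ((d : A →ₗ[k] A) ^ n) a = 0) : ConformalAlgebra k A[X] where
  der := LinearMap.mulLeft k X
  prod := diffProd d
  locality := diffProd_local d hd
  prod_der_left := diffProd_X_mul_left d
  prod_der_right := diffProd_X_mul_right d

/-- Both sides obey the same sesquilinearity rules in `f` and `g`, so these may be taken constant.
For constants `a`, `b` the identity is the Leibniz rule for `a D^n (b · D^m h)`, with `h` arbitrary.
-/
theorem diffConformal_isAssociative (d : Derivation k A A)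
    (hd : ∀ a, ∃ N : ℕ, ∀ n, N ≤ n → ((d : A →ₗ[k] A) ^ n) a = 0) :
    let := diffConformal d hd
    IsAssociative k A[X] := by
  let := diffConformal d hd
  constructor
  intro n m f g h
  change _ = nested (k := k) n m f g h
  induction f using induction_X_mul generalizing n m with
  | hX f hf =>
    change prod (k := k) n (der (k := k) f) _ = nested n m (der (k := k) f) g h
    rw [nested_der_left, prod_der_left, hf]
  | hadd f f' hf hf' =>
    rw [nested_add_left, ← hf, ← hf', map_add, LinearMap.add_apply]
  | hC a =>
    induction g using induction_X_mul generalizing n m with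
    | hX g hg =>
      change prod (k := k) n (C a) (prod (k := k) m (der (k := k) g) h) =
        nested n m (C a) (der (k := k) g) h
      rw [nested_der_mid, prod_der_left, map_neg, map_smul, hg]
    | hadd g g' hg hg' =>
      rw [nested_add_mid, ← hg, ← hg', map_add, LinearMap.add_apply, map_add]
    | hC b =>
      simp only [nested]
      change diffProd d n (C a) (diffProd d m (C b) h) = ∑ s ∈ Finset.range (n + 1),
        (n.choose s : k) • diffProd d (n + m - s) (diffProd d s (C a) (C b)) h
      rw [diffProd_C_left, diffProd_C_left, Derivation.pow_apply_mul, Finset.mul_sum]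
      refine Finset.sum_congr rfl fun s hs => ?_
      have hs : s ≤ n := by simpa [Nat.lt_succ_iff] using hs
      rw [diffProd_C_left, extendDer_pow_C, ← C_mul, diffProd_C_left, mul_smul_comm,
        ← Module.End.mul_apply, ← pow_add, show n - s + m = n + m - s by omega, C_mul, mul_assoc]

end Polynomial

/-! ### Criteria for linear independence -/

/-- A family is linearly independent if it is triangular with respect to a family of functionals
and a rank function. -/
theorem linearIndependent_of_triangular {k ι α V : Type*} [Field k] [AddCommGroup V] [Module k V]
    [LinearOrder α] (b : ι → V) (r : ι → α) (c : ι → V →ₗ[k] k) (hne : ∀ i, c i (b i) ≠ 0)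
    (hzero : ∀ i j, j ≠ i → r j ≤ r i → c i (b j) = 0) : LinearIndependent k b := by
  rw [linearIndependent_iff]
  intro l hl
  by_contra h
  -- The index of largest rank in the support is chosen: its functional kills every other term of
  -- the relation.
  obtain ⟨i, hi, hmax⟩ := l.support.exists_max_image r (Finsupp.support_nonempty_iff.2 h)
  have := congrArg (c i) hl
  rw [Finsupp.linearCombination_apply, Finsupp.sum, map_sum, map_zero,
    Finset.sum_eq_single_of_mem i hi] at this
  · rw [map_smul, smul_eq_mul] at this
    exact (mul_ne_zero (Finsupp.mem_support_iff.1 hi) (hne i)) this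
  · intro j hj hji
    rw [map_smul, hzero i j hji (hmax j hj), smul_zero]

/-- A family in `V` is linearly independent over `k[X]`, with `X` acting as `T`, if its images under
the powers of `T` are linearly independent over `k`. -/
theorem Module.AEval'.linearIndependent_of_pow {k ι V : Type*} [Field k] [AddCommGroup V]
    [Module k V] (T : V →ₗ[k] V) (b : ι → V)
    (h : LinearIndependent k fun p : ι × ℕ => (T ^ p.2) (b p.1)) :
    LinearIndependent k[X] fun i => Module.AEval'.of T (b i) := by
  rw [linearIndependent_iff']
  intro s g hg i hi
  rw [linearIndependent_iff'] at h
  -- A common strict bound for the degrees turns a relation over `k[X]` into one finite relation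
  -- over `k`, indexed by `s × range N`.
  let N := s.sup fun i => (g i).natDegree + 1
  have hN : ∀ i ∈ s, (g i).natDegree < N := fun i hi =>
    Finset.le_sup (f := fun i => (g i).natDegree + 1) hi
  have h0 := congrArg (Module.AEval'.of T).symm hg
  rw [map_sum, map_zero] at h0
  have key := h (s ×ˢ Finset.range N) (fun p => (g p.1).coeff p.2) (by
    rw [Finset.sum_product, ← h0]
    refine Finset.sum_congr rfl fun j hj => ?_
    rw [Module.AEval.of_symm_smul, LinearEquiv.symm_apply_apply, aeval_eq_sum_range' (hN j hj)]
    simp)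
  ext n
  rw [coeff_zero]
  by_cases hn : n < N
  · exact key (i, n) (by simp [hi, hn])
  · exact coeff_eq_zero_of_natDegree_lt ((hN i hi).trans_le (not_lt.1 hn))

/-! ### Homomorphisms out of the envelope -/

namespace ConformalAlgebra

section Lift

variable {k : Type*} [Field k]
variable {L : Type*} [AddCommGroup L] [Module k L] [ConformalAlgebra k L]
variable {C : Type*} [AddCommGroup C] [Module k C] [ConformalAlgebra k C]
variable {X : Set L} {hX : GeneratesModule k X} {N : X → X → ℕ}

/-- A map from `L` to an associative conformal algebra that satisfies the defining relations of the
envelope on `X` extends to the envelope. -/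
theorem Envelope.exists_isHom [IsAssociative k C] {φ : L →ₗ[k] C}
    (hder : ∀ x, φ (der (k := k) x) = der (k := k) (φ x))
    (hloc : ∀ (x y : X) (n : ℕ), N x y ≤ n → prod (k := k) n (φ x) (φ y) = 0)
    (hcomm : ∀ (x y : X) (n : ℕ), φ (prod (k := k) n (x : L) (y : L)) =
      prod (k := k) n (φ x) (φ y) - curly k n (φ y) (φ x)) :
    ∃ f : Envelope k X hX N →ₗ[k] C, IsHom f ∧ ∀ l, f (ι hX N l) = φ l := by
  let g : FreeWords k L →ₗ[k] C := Finsupp.linearCombination k (evalWord φ)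
  have gof : ∀ l, g (FreeWords.of k l) = φ l := fun l => by
    simp [g, FreeWords.of, evalWord]
  have gder : ∀ a, g (FreeWords.der a) = der (k := k) (g a) := by
    intro a
    induction a using Finsupp.induction_linear with
    | zero => simp
    | add f h hf hh => simp only [map_add, hf, hh]
    | single w c => simp [g, FreeWords.der, evalWord]
  have gprod : ∀ n a b, g (FreeWords.prod n a b) = prod (k := k) n (g a) (g b) := by
    intro n a b
    induction a using Finsupp.induction_linear with
    | zero => simp
    | add f h hf hh => simp only [map_add, LinearMap.add_apply, hf, hh]
    | single w c =>
      induction b using Finsupp.induction_linear with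
      | zero => simp
      | add f h hf hh => simp only [map_add, hf, hh]
      | single w' c' =>
        have e : FreeWords.prod n (Finsupp.single w c) (Finsupp.single w' c') =
            Finsupp.single (Word.prod n w w') (c * c') := by
          simp [FreeWords.prod, Finsupp.linearCombination_single]
        rw [e]
        simp only [g, Finsupp.linearCombination_single, evalWord, map_smul, LinearMap.smul_apply,
          smul_smul]
        rw [mul_comm c c']
  have gdiv : ∀ s a, g (FreeWords.divDer s a) = divDer k s (g a) := by
    intro s a
    simp only [FreeWords.divDer, divDer, LinearMap.smul_apply, map_smul]
    congr 1
    induction s with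
    | zero => rfl
    | succ t ih => rw [pow_succ', pow_succ', Module.End.mul_apply, Module.End.mul_apply,
        gder, ih]
  have hideal : IsEnvIdeal X N (LinearMap.ker g) :=
    { rel := by
        intro a ha
        rw [LinearMap.mem_ker]
        cases ha with
        | add l l' => simp [gof]
        | smul c l => simp [gof]
        | der l => simp [gof, gder, hder]
        | prod_der_left n a b => simp [gprod, gder, prod_der_left]
        | prod_der_right n a b => simp [gprod, gder, prod_der_right]
        | assoc n m a b c =>
          simp only [map_sub, map_sum, map_smul, gprod, IsAssociative.assoc, sub_self]
        | loc x y n h => rw [gprod, gof, gof, hloc x y n h]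
        | comm x y n =>
          simp only [map_sub, map_sum, map_smul, gprod, gdiv, gof, hcomm]
          -- The relation cuts the sum off at `N y x - n`, beyond which all terms vanish by
          -- locality.
          rw [curly_eq_sum (hloc y x) n (N y x - n) (by omega), sub_self]
      der := fun a ha => by
        rw [LinearMap.mem_ker] at ha ⊢
        rw [gder, ha, map_zero]
      prod_left := fun n a ha b => by
        rw [LinearMap.mem_ker] at ha ⊢
        rw [gprod, ha, map_zero, LinearMap.zero_apply]
      prod_right := fun n a b hb => by
        rw [LinearMap.mem_ker] at hb ⊢
        rw [gprod, hb, map_zero] }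
  refine ⟨(envIdeal k X N).liftQ g (sInf_le hideal), ⟨fun u => ?_, fun n u w => ?_⟩, gof⟩
  · obtain ⟨a, rfl⟩ := mk_surjective u
    exact gder a
  · obtain ⟨a, rfl⟩ := mk_surjective u
    obtain ⟨b, rfl⟩ := mk_surjective w
    exact gprod n a b

end Lift

/-! ### The density model and its Virasoro element -/

namespace Vir

set_option maxSynthPendingDepth 6

variable (k : Type*) [Field k]

/-- The polynomials in `Δ`, `x` and `∂` (from the inside to the outside). -/
abbrev DensityModel : Type _ := k[X][X][X]

/-- The derivation `d/dx` of `k[Δ][x]`. -/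
noncomputable def derX : Derivation k k[X][X] k[X][X] :=
  (derivative' (R := k[X])).restrictScalars k

theorem derX_apply (a : k[X][X]) : derX k a = derivative a := rfl

theorem derX_nilpotent (a : k[X][X]) :
    ∃ N : ℕ, ∀ n, N ≤ n → ((derX k : k[X][X] →ₗ[k] k[X][X]) ^ n) a = 0 := by
  refine ⟨a.natDegree + 1, fun n hn => ?_⟩
  rw [Module.End.pow_apply]
  exact iterate_derivative_eq_zero (by omega)

noncomputable instance : ConformalAlgebra k (DensityModel k) :=
  diffConformal (derX k) (derX_nilpotent k)

instance : IsAssociative k (DensityModel k) :=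
  diffConformal_isAssociative (derX k) (derX_nilpotent k)

/-- The image `x - Δ∂` of the generator of `Vir`: the symbol of its action on the densities of
weight `Δ`. -/
noncomputable def vM : DensityModel k := C X - X * C (C X)

/-- The derivation of `k[Δ, x, ∂]` with `Δ ↦ 0`, `x ↦ 1`, `∂ ↦ 1`. -/
noncomputable abbrev DM : Derivation k (DensityModel k) (DensityModel k) := extendDer (derX k)

variable {k}

theorem der_model (f : DensityModel k) : der (k := k) f = X * f := rfl

/-- At `∂ = -λ` the element `x - Δ∂` becomes `x + Δλ`, so its λ-product with `f` is `(x + Δλ) e^{λD}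
f`. -/
theorem prod_vM (n : ℕ) (f : DensityModel k) : prod (k := k) n (vM k) f =
    C X * ((DM k : DensityModel k →ₗ[k] DensityModel k) ^ n) f +
      (n : k) • (C (C X) * ((DM k : DensityModel k →ₗ[k] DensityModel k) ^ (n - 1)) f) := by
  change diffProd (derX k) n (C X - X * C (C X)) f = _
  rw [map_sub, LinearMap.sub_apply, diffProd_C_left, diffProd_X_mul_left, diffProd_C_left,
    sub_neg_eq_add]

theorem DM_C_C (p : k[X]) : DM k (C (C p)) = 0 := by
  rw [extendDer_C, derX_apply, derivative_C, C_0]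

theorem DM_C_X : DM k (C X) = 1 := by
  rw [extendDer_C, derX_apply, derivative_X, C_1]

theorem DM_vM : DM k (vM k) = 1 - C (C X) := by
  rw [vM, map_sub, DM_C_X, Derivation.leibniz, DM_C_C, extendDer_X]
  simp

/-- Already `D(x - Δ∂) = 1 - Δ` is killed by `D`. Since the `n`-th product involves only `D^n` and
`D^(n-1)`, this yields the locality bound `3`. -/
theorem DM_pow_vM (n : ℕ) :
    ((DM k : DensityModel k →ₗ[k] DensityModel k) ^ (n + 2)) (vM k) = 0 := by
  rw [pow_add, pow_two, Module.End.mul_apply, Module.End.mul_apply, Derivation.coeFn_coe, DM_vM,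
    map_sub, DM_C_C, Derivation.map_one_eq_zero, sub_zero, map_zero]

theorem prod_zero_vM (f : DensityModel k) : prod (k := k) 0 (vM k) f = C X * f := by
  simp [prod_vM]

theorem prod_one_vM (f : DensityModel k) :
    prod (k := k) 1 (vM k) f = C X * DM k f + C (C X) * f := by
  simp [prod_vM]

theorem prod_two_vM_vM :
    prod (k := k) 2 (vM k) (vM k) = (2 : k) • (C (C (X * (1 - X))) : DensityModel k) := by
  rw [prod_vM, DM_pow_vM 0, mul_zero, zero_add, pow_one, Derivation.coeFn_coe, DM_vM]
  push_cast
  congr 1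
  simp

theorem prod_vM_vM_of_le {n : ℕ} (hn : 3 ≤ n) : prod (k := k) n (vM k) (vM k) = 0 := by
  obtain ⟨n, rfl⟩ := Nat.exists_eq_add_of_le' hn
  rw [prod_vM, show n + 3 - 1 = n + 2 from rfl, show n + 3 = n + 1 + 2 from rfl, DM_pow_vM,
    DM_pow_vM, mul_zero, mul_zero, smul_zero, add_zero]

/-- These are the brackets `(∂ + 2λ)v` of `Vir`. The products `v_(1) v = x - Δ²∂` and `v_(2) v =
2Δ(1 - Δ)` are not linear in `Δ`, but the `Δ²` terms cancel in the commutators. -/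
theorem commutator_vM [CharZero k] (n : ℕ) :
    prod (k := k) n (vM k) (vM k) - curly k n (vM k) (vM k) =
      if n = 0 then X * vM k else if n = 1 then (2 : k) • vM k else 0 := by
  have hloc : ∀ m, 3 ≤ m → prod (k := k) m (vM k) (vM k) = 0 := fun m hm => prod_vM_vM_of_le hm
  rw [curly_eq_sum hloc n (3 - n) (by omega)]
  rcases n with _ | _ | _ | n
  · simp [Finset.sum_range_succ, divDer, prod_two_vM_vM, prod_one_vM, prod_zero_vM, der_model,
      pow_two, DM_vM]
    rw [vM]
    ring
  · simp [Finset.sum_range_succ, divDer, prod_two_vM_vM, prod_one_vM, der_model, DM_vM]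
    rw [two_smul, two_smul, vM]
    ring
  · simp [divDer]
  · rw [hloc _ (by omega)]
    simp

theorem prod_zero_pow_model (n : ℕ) (f : DensityModel k) :
    ((prod (k := k) 0 (vM k)) ^ n) f = C (X ^ n) * f := by
  induction n with
  | zero => simp
  | succ n ih =>
    rw [pow_succ', Module.End.mul_apply, ih, prod_zero_vM, pow_succ', C_mul, mul_assoc]

theorem der_pow_model (n : ℕ) (f : DensityModel k) :
    ((der (k := k) (C := DensityModel k)) ^ n) f = X ^ n * f := by
  induction n with
  | zero => simp
  | succ n ih => rw [pow_succ', Module.End.mul_apply, ih, der_model, pow_succ', mul_assoc]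

/-- On polynomials in `Δ` the derivation `D` vanishes, so `L_1 = xD + Δ` is multiplication by `Δ`.
-/
theorem prod_one_pow_C (m : ℕ) (p : k[X]) :
    ((prod (k := k) 1 (vM k)) ^ m) (C (C p) : DensityModel k) = C (C (X ^ m * p)) := by
  induction m with
  | zero => simp
  | succ m ih =>
    rw [pow_succ', Module.End.mul_apply, ih, prod_one_vM, DM_C_C, mul_zero, zero_add, ← C_mul,
      ← C_mul, pow_succ', mul_assoc]

/-- Since `D x = D∂ = 1`, the operator `L_1` sends `x p(Δ) - ∂ q(Δ)` to `x((1 + Δ)p - q) - ∂ Δq`.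
Starting from `p = 1`, `q = Δ`, this recurrence has the stated solution. -/
theorem prod_one_pow_vM (m : ℕ) :
    ((prod (k := k) 1 (vM k)) ^ m) (vM k) =
      C (X * C ((1 - X) * (1 + X) ^ m + X ^ (m + 1))) - X * C (C (X ^ (m + 1))) := by
  induction m with
  | zero => simp [vM]
  | succ m ih =>
    have h (p : k[X]) : derivative (X * C p) = C p := by simp
    rw [pow_succ', Module.End.mul_apply, ih, prod_one_vM, map_sub, extendDer_C, derX_apply, h,
      Derivation.leibniz, DM_C_C, extendDer_X]
    simp only [C_mul, C_add, C_sub, C_pow, C_1, smul_eq_mul, mul_zero, zero_add, mul_one]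
    ring

/-! ### Independence of the images in the model -/

/-- The coefficient of `∂^s x^n Δ^m`. -/
noncomputable def modelCoeff (s n m : ℕ) : DensityModel k →ₗ[k] k :=
  lcoeff k m ∘ₗ ((lcoeff k[X] n).restrictScalars k) ∘ₗ ((lcoeff k[X][X] s).restrictScalars k)

theorem modelCoeff_apply (s n m : ℕ) (f : DensityModel k) :
    modelCoeff s n m f = ((f.coeff s).coeff n).coeff m := rfl

theorem modelCoeff_mul (a j s n m : ℕ) (f : DensityModel k) :
    modelCoeff s n m (C (X ^ a) * (X ^ j * f)) =
      if a ≤ n ∧ j ≤ s then modelCoeff (s - j) (n - a) m f else 0 := by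
  rw [modelCoeff_apply, coeff_C_mul, coeff_X_pow_mul', coeff_X_pow_mul']
  split_ifs <;> simp_all [modelCoeff_apply]

theorem modelCoeff_C (s n m : ℕ) (p : k[X]) :
    modelCoeff s n m (C (C p) : DensityModel k) = if s = 0 ∧ n = 0 then p.coeff m else 0 := by
  rw [modelCoeff_apply, coeff_C]
  split_ifs <;> simp_all [coeff_C]

theorem modelCoeff_sub (s n m : ℕ) (p q : k[X]) :
    modelCoeff s n m (C (X * C p) - X * C (C q) : DensityModel k) =
      (if s = 0 ∧ n = 1 then p.coeff m else 0) - if s = 1 ∧ n = 0 then q.coeff m else 0 := by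
  rw [modelCoeff_apply, coeff_sub, mul_comm X (C (C q)), coeff_C_mul_X, coeff_C, X_mul_C]
  rcases s with _ | _ | s <;> simp
  · rw [coeff_X]; split_ifs <;> first | omega | simp
  · rw [coeff_C]; split_ifs <;> simp

theorem modelCoeff_two_smul (s n m p : ℕ) :
    modelCoeff s n m ((2 : k) • (C (C (X ^ p * (X * (1 - X)))) : DensityModel k)) =
      if s = 0 ∧ n = 0 then 2 * ((if m = p + 1 then 1 else 0) - if m = p + 2 then 1 else 0)
      else (0 : k) := by
  rw [map_smul, modelCoeff_C, show (X ^ p * (X * (1 - X)) : k[X]) = X ^ (p + 1) - X ^ (p + 2) by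
    ring, coeff_sub, coeff_X_pow, coeff_X_pow]
  split_ifs <;> simp

/-- The images of the elements `L_0^n ∂^s L_1^m v` and `L_0^n L_1^m L_2 v`. -/
theorem linearIndependent_model [CharZero k] : LinearIndependent k
    (Sum.elim
      (fun p : ℕ × ℕ × ℕ => ((prod (k := k) 0 (vM k)) ^ p.1)
        ((der (k := k) ^ p.2.1) (((prod (k := k) 1 (vM k)) ^ p.2.2) (vM k))))
      (fun p : ℕ × ℕ => ((prod (k := k) 0 (vM k)) ^ p.1)
        (((prod (k := k) 1 (vM k)) ^ p.2) (prod (k := k) 2 (vM k) (vM k))))) := by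
  have hx : ∀ n s m : ℕ, ((prod (k := k) 0 (vM k)) ^ n)
        ((der (k := k) ^ s) (((prod (k := k) 1 (vM k)) ^ m) (vM k))) = C (X ^ n) * (X ^ s *
          (C (X * C ((1 - X) * (1 + X) ^ m + X ^ (m + 1))) - X * C (C (X ^ (m + 1))))) := by
    intro n s m
    rw [prod_zero_pow_model, der_pow_model, prod_one_pow_vM]
  -- The factor `X ^ 0` gives both kinds of images the shape required by `modelCoeff_mul`.
  have hy : ∀ n m : ℕ, ((prod (k := k) 0 (vM k)) ^ n)
        (((prod (k := k) 1 (vM k)) ^ m) (prod (k := k) 2 (vM k) (vM k))) =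
        C (X ^ n) * (X ^ 0 * ((2 : k) • (C (C (X ^ m * (X * (1 - X)))) : DensityModel k))) := by
    intro n m
    rw [prod_zero_pow_model, prod_two_vM_vM, map_smul, prod_one_pow_C, pow_zero, one_mul]
  -- In the first kind the top power of `∂` carries `-x^n ∂^(s+1) Δ^(m+1)`, which is the chosen
  -- monomial; the complicated `x`-part has lower degree in `∂`. In the second kind, `2x^n(Δ^(m+1) -
  -- Δ^(m+2))`, the monomial is `x^n Δ^(m+2)`. It also occurs for `m + 1`, hence the rank by `m`.
  -- The shift to `s + 1` ranks the second kind, free of `∂`, below the first.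
  refine linearIndependent_of_triangular _
    (Sum.elim (fun p => toLex (p.2.1 + 1, 0)) (fun p => toLex (0, p.2)) : _ → ℕ ×ₗ ℕ)
    (Sum.elim (fun p => modelCoeff (p.2.1 + 1) p.1 (p.2.2 + 1))
      (fun p => modelCoeff 0 p.1 (p.2 + 2))) ?_ ?_
  · rintro (⟨n, s, m⟩ | ⟨n, m⟩)
    · simp only [Sum.elim_inl, hx, modelCoeff_mul, modelCoeff_sub]
      simp
    · simp only [Sum.elim_inr, hy, modelCoeff_mul, modelCoeff_two_smul]
      simp
  · rintro (⟨n, s, m⟩ | ⟨n, m⟩) (⟨n', s', m'⟩ | ⟨n', m'⟩) hne hle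
    · simp only [ne_eq, Sum.inl.injEq, Prod.mk.injEq, Sum.elim_inl,
        Prod.Lex.toLex_le_toLex] at hne hle
      simp only [Sum.elim_inl, hx, modelCoeff_mul, modelCoeff_sub, coeff_X_pow]
      split_ifs <;> first | omega | simp
    · simp only [Sum.elim_inl, Sum.elim_inr, hy, modelCoeff_mul, modelCoeff_two_smul]
      simp
    · simp [Prod.Lex.toLex_le_toLex] at hle
    · simp only [ne_eq, Sum.inr.injEq, Prod.mk.injEq, Sum.elim_inr,
        Prod.Lex.toLex_le_toLex] at hne hle
      simp only [Sum.elim_inr, hy, modelCoeff_mul, modelCoeff_two_smul]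
      split_ifs <;> first | omega | simp

/-- The images of the elements `∂^s L_0^n v` and `∂^s L_0^n L_1^m L_2 v`. -/
theorem linearIndependent_model_der [CharZero k] : LinearIndependent k
    (fun p : (ℕ ⊕ ℕ × ℕ) × ℕ => (der (k := k) ^ p.2) (Sum.elim
      (fun n : ℕ => ((prod (k := k) 0 (vM k)) ^ n) (vM k))
      (fun p : ℕ × ℕ => ((prod (k := k) 0 (vM k)) ^ p.1)
        (((prod (k := k) 1 (vM k)) ^ p.2) (prod (k := k) 2 (vM k) (vM k)))) p.1)) := by
  have hx : ∀ n s : ℕ, (der (k := k) ^ s) (((prod (k := k) 0 (vM k)) ^ n) (vM k)) =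
      C (X ^ n) * (X ^ s * (C (X * C 1) - X * C (C X))) := by
    intro n s
    rw [prod_zero_pow_model, der_pow_model, mul_left_comm, vM, C_1, mul_one]
  have hy : ∀ n m s : ℕ, (der (k := k) ^ s) (((prod (k := k) 0 (vM k)) ^ n)
        (((prod (k := k) 1 (vM k)) ^ m) (prod (k := k) 2 (vM k) (vM k)))) =
        C (X ^ n) * (X ^ s * ((2 : k) • (C (C (X ^ m * (X * (1 - X)))) : DensityModel k))) := by
    intro n m s
    rw [prod_zero_pow_model, prod_two_vM_vM, map_smul, prod_one_pow_C, der_pow_model,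
      mul_left_comm]
  -- At `Δ = 0` the images of `∂^s L_0^n v` are the distinct monomials `∂^s x^(n+1)`, while those of
  -- the other kind vanish. So the former get rank `⊤`, and the latter are ordered by the degree in
  -- `Δ`.
  refine linearIndependent_of_triangular _
    (fun p => Sum.elim (fun _ => ⊤) (fun q => (q.2 : WithTop ℕ)) p.1)
    (fun p => Sum.elim (fun n => modelCoeff p.2 (n + 1) 0)
      (fun q => modelCoeff p.2 q.1 (q.2 + 2)) p.1) ?_ ?_
  · rintro ⟨n | ⟨n, m⟩, s⟩
    · simp only [Sum.elim_inl, hx, modelCoeff_mul, modelCoeff_sub]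
      simp
    · simp only [Sum.elim_inr, hy, modelCoeff_mul, modelCoeff_two_smul]
      simp
  · rintro ⟨n | ⟨n, m⟩, s⟩ ⟨n' | ⟨n', m'⟩, s'⟩ hne hle
    · simp only [ne_eq, Sum.inl.injEq, Prod.mk.injEq] at hne
      simp only [Sum.elim_inl, hx, modelCoeff_mul, modelCoeff_sub, coeff_X_zero]
      split_ifs <;> first | omega | simp
    · simp only [Sum.elim_inl, Sum.elim_inr, hy, modelCoeff_mul, modelCoeff_two_smul]
      simp
    · simp at hle
    · simp only [ne_eq, Sum.inr.injEq, Prod.mk.injEq, Sum.elim_inr, Nat.cast_le] at hne hle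
      simp only [Sum.elim_inr, hy, modelCoeff_mul, modelCoeff_two_smul]
      split_ifs <;> first | omega | simp

/-! ### Relations between the operators and generation of the envelope -/

/-- A subspace of the envelope that contains `v` and is stable under `∂` and all `L_n` is the whole
envelope. -/
theorem eq_top_of_stable {N : ℕ} (p : Submodule k (VirEnvelope k N)) (hv : vU k N ∈ p)
    (hder : ∀ u ∈ p, der (k := k) u ∈ p) (hL : ∀ n, ∀ u ∈ p, Lop k N n u ∈ p) : p = ⊤ := by
  have hι_der : ∀ x : Vir k, Envelope.ι (generatesModule k) (fun _ _ => N) (der (k := k) x) =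
      der (k := k) (Envelope.ι (generatesModule k) (fun _ _ => N) x) := Envelope.ι_der
  -- The subspace is a left ideal; as it contains the image of `Vir`, all words then lie in it.
  have hmul : ∀ u : VirEnvelope k N, ∀ w ∈ p, ∀ n, prod (k := k) n u w ∈ p := by
    intro u
    induction u using Envelope.induction with
    | hof l =>
      change ∀ w ∈ p, ∀ n, prod (k := k) n (Envelope.ι (generatesModule k) (fun _ _ => N) l) w ∈ p
      intro w hw
      induction l using Vir.induction with
      | hv => exact fun n => hL n w hw
      | hadd x y hx hy =>
        intro n
        rw [map_add, map_add, LinearMap.add_apply]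
        exact p.add_mem (hx n) (hy n)
      | hsmul c x hx =>
        intro n
        rw [map_smul, map_smul, LinearMap.smul_apply]
        exact p.smul_mem c (hx n)
      | hder x hx =>
        intro n
        rw [hι_der, prod_der_left]
        exact p.neg_mem (p.smul_mem _ (hx _))
    | hder u ih =>
      intro w hw n
      change prod (k := k) n (der (k := k) u) w ∈ p
      rw [prod_der_left]
      exact p.neg_mem (p.smul_mem _ (ih w hw _))
    | hprod n u u' ihu ihu' =>
      intro w hw m
      change prod (k := k) m (prod (k := k) n u u') w ∈ p
      induction n using Nat.strong_induction_on generalizing m with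
      | _ n ih =>
        -- Associativity is solved for its last term `(u_(n) u')_(m) w`; the remaining terms involve
        -- `u_(s) u'` with `s < n`, covered by induction on `n`.
        have h := IsAssociative.assoc (k := k) n m u u' w
        rw [Finset.sum_range_succ, Nat.choose_self, Nat.cast_one, one_smul,
          Nat.add_sub_cancel_left, ← sub_eq_iff_eq_add'] at h
        rw [← h]
        exact p.sub_mem (ihu _ (ihu' w hw m) n) (p.sum_mem fun s hs => p.smul_mem _
          (ih s (Finset.mem_range.1 hs) _))
    | hzero => intro w _ n; rw [map_zero, LinearMap.zero_apply]; exact p.zero_mem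
    | hadd u u' hu hu' =>
      intro w hw n
      rw [map_add, LinearMap.add_apply]
      exact p.add_mem (hu w hw n) (hu' w hw n)
    | hsmul c u hu =>
      intro w hw n
      rw [map_smul, LinearMap.smul_apply]
      exact p.smul_mem c (hu w hw n)
  refine Submodule.eq_top_iff'.2 fun u => ?_
  induction u using Envelope.induction with
  | hof l =>
    change Envelope.ι (generatesModule k) (fun _ _ => N) l ∈ p
    induction l using Vir.induction with
    | hv => exact hv
    | hadd x y hx hy => rw [map_add]; exact p.add_mem hx hy
    | hsmul c x hx => rw [map_smul]; exact p.smul_mem c hx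
    | hder x hx => rw [hι_der]; exact hder _ hx
  | hder u ih => exact hder u ih
  | hprod n u w _ ihw => exact hmul u w ihw n
  | hzero => exact p.zero_mem
  | hadd u w ihu ihw => exact p.add_mem ihu ihw
  | hsmul c u ih => exact p.smul_mem c ih

theorem Lop_vU_of_le {N n : ℕ} (hn : N ≤ n) : Lop k N n (vU k N) = 0 :=
  Envelope.mk_rel (EnvRel.loc (⟨v k, rfl⟩ : ({v k} : Set (Vir k))) ⟨v k, rfl⟩ n hn)

theorem Lop_der (N n : ℕ) (u : VirEnvelope k N) :
    Lop k N n (der (k := k) u) = der (k := k) (Lop k N n u) + (n : k) • Lop k N (n - 1) u :=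
  prod_der_right n (vU k N) u

/-- `L_1 v = v + (1/2) ∂ L_2 v`. -/
theorem Lop_one_vU [CharZero k] : Lop k 3 1 (vU k 3) =
    vU k 3 + (2 : k)⁻¹ • der (k := k) (Lop k 3 2 (vU k 3)) := by
  -- The commutator identity for `[v_(1) v] = 2v` becomes `2v = 2 L_1 v - ∂ L_2 v`.
  have h := (Envelope.isEnvelope (hX := generatesModule k) (N := fun _ _ => 3)).hom.map_prod 1
    (v k) (v k)
  change _ = _ - curly k 1 (vU k 3) (vU k 3) at h
  rw [curly_eq_sum (B := 3) (fun n hn => Lop_vU_of_le hn) 1 2 (by omega), prod_v_v, if_neg (by simp),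
    if_pos rfl, map_smul] at h
  change (2 : k) • vU k 3 = Lop k 3 1 (vU k 3) - _ at h
  simp only [Finset.sum_range_succ, Finset.range_zero, Finset.sum_empty, zero_add, divDer,
    add_zero, Nat.factorial_zero, Nat.factorial_one, Nat.cast_one, inv_one, one_smul, pow_zero,
    pow_one, Module.End.one_apply] at h
  change (2 : k) • vU k 3 = Lop k 3 1 (vU k 3) -
    ((-1 : k) • Lop k 3 1 (vU k 3) + (-1 : k) ^ 2 • der (k := k) (Lop k 3 2 (vU k 3))) at h
  have h2 : (2 : k) ≠ 0 := two_ne_zero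
  have h3 : Lop k 3 1 (vU k 3) = (2 : k)⁻¹ • (2 : k) • Lop k 3 1 (vU k 3) := by
    rw [inv_smul_smul₀ h2]
  have h4 : vU k 3 = (2 : k)⁻¹ • (2 : k) • vU k 3 := by rw [inv_smul_smul₀ h2]
  rw [h3]
  nth_rewrite 2 [h4]
  rw [h]
  module

/-- `L_n L_m` in terms of the products with `v_(0) v`, `v_(1) v` and `v_(2) v`. -/
theorem Lop_Lop (n m : ℕ) (u : VirEnvelope k 3) : Lop k 3 n (Lop k 3 m u) =
    prod (k := k) (n + m) (Lop k 3 0 (vU k 3)) u +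
      (n : k) • prod (k := k) (n + m - 1) (Lop k 3 1 (vU k 3)) u +
      (n.choose 2 : k) • prod (k := k) (n + m - 2) (Lop k 3 2 (vU k 3)) u := by
  have h := IsAssociative.assoc (k := k) n m (vU k 3) (vU k 3) u
  -- Zero binomials are appended so that three terms can be split off uniformly, even for `n < 2`.
  have hsum : ∀ f : ℕ → VirEnvelope k 3, ∑ s ∈ Finset.range (n + 1), (n.choose s : k) • f s =
      ∑ s ∈ Finset.range (n + 3), (n.choose s : k) • f s := by
    intro f
    rw [Finset.sum_range_succ _ (n + 2), Finset.sum_range_succ _ (n + 1),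
      Nat.choose_eq_zero_of_lt (by omega), Nat.choose_eq_zero_of_lt (by omega)]
    simp
  rw [hsum, Finset.sum_range_succ', Finset.sum_range_succ', Finset.sum_range_succ',
    Finset.sum_eq_zero] at h
  · refine h.trans ?_
    simp only [zero_add, Nat.choose_zero_right, Nat.choose_one_right, Nat.cast_one, one_smul,
      Nat.sub_zero]
    change (n.choose 2 : k) • prod (k := k) (n + m - 2) (Lop k 3 2 (vU k 3)) u +
      (n : k) • prod (k := k) (n + m - 1) (Lop k 3 1 (vU k 3)) u +
      prod (k := k) (n + m) (Lop k 3 0 (vU k 3)) u = _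
    abel
  · intro s _
    change (n.choose (s + 1 + 1 + 1) : k) •
      prod (k := k) (n + m - (s + 1 + 1 + 1)) (Lop k 3 (s + 1 + 1 + 1) (vU k 3)) u = 0
    rw [Lop_vU_of_le (by omega), map_zero, LinearMap.zero_apply, smul_zero]

/-- Substituting `L_1 v = v + ∂e/2`, with `e = L_2 v`, and using `(∂e)_(n) = -n e_(n-1)` eliminates
`v_(1) v`. In `L_n L_m` the coefficient of the product with `e` then becomes `-nm/2`; its symmetry
makes these terms cancel in the commutators. -/
theorem prod_Lop_one_vU [CharZero k] (n : ℕ) (u : VirEnvelope k 3) :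
    prod (k := k) n (Lop k 3 1 (vU k 3)) u = Lop k 3 n u -
      ((2 : k)⁻¹ * n) • prod (k := k) (n - 1) (Lop k 3 2 (vU k 3)) u := by
  rw [Lop_one_vU, map_add, LinearMap.add_apply, map_smul, LinearMap.smul_apply, prod_der_left,
    smul_neg, smul_smul, sub_eq_add_neg]
  rfl

theorem cast_choose_two_eq [CharZero k] (n : ℕ) :
    (n.choose 2 : k) = (2 : k)⁻¹ * (n * (n - 1)) := by
  rw [Nat.cast_choose_two, div_eq_inv_mul]

/-- `[L_n, L_0] = n L_(n-1)`. -/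
theorem Lop_Lop_zero [CharZero k] (n : ℕ) (u : VirEnvelope k 3) :
    Lop k 3 n (Lop k 3 0 u) = Lop k 3 0 (Lop k 3 n u) + (n : k) • Lop k 3 (n - 1) u := by
  rw [Lop_Lop n 0, Lop_Lop 0 n, prod_Lop_one_vU, cast_choose_two_eq]
  rcases n with _ | n
  · simp
  · simp only [Nat.add_zero, Nat.zero_add, Nat.add_sub_cancel, Nat.cast_zero, zero_smul,
      show n + 1 - 2 = n - 1 from rfl, Nat.choose_zero_succ]
    push_cast
    module

/-- `[L_n, L_1] = (n - 1) L_n`. -/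
theorem Lop_Lop_one [CharZero k] (n : ℕ) (u : VirEnvelope k 3) :
    Lop k 3 n (Lop k 3 1 u) = Lop k 3 1 (Lop k 3 n u) + ((n : k) - 1) • Lop k 3 n u := by
  rw [Lop_Lop n 1, Lop_Lop 1 n, Nat.add_comm 1 n, Nat.add_sub_cancel, prod_Lop_one_vU,
    cast_choose_two_eq, cast_choose_two_eq, show n + 1 - 2 = n - 1 by omega]
  push_cast
  module

/-- `L_n L_2 v = 0` for `n ≥ 2`. -/
theorem Lop_Lop_two_vU [CharZero k] {n : ℕ} (hn : 2 ≤ n) :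
    Lop k 3 n (Lop k 3 2 (vU k 3)) = 0 := by
  have hloc : ∀ s m, 3 ≤ m → prod (k := k) m (Lop k 3 s (vU k 3)) (vU k 3) = 0 := fun s m hm =>
    Envelope.local_left (fun m hm => Lop_vU_of_le hm) _ _ _ hm
  -- The third product of `v_(1) v` with `v` vanishes by locality; after the elimination it equals
  -- `L_3 v - (3/2) e_(2) v`, where `L_3 v = 0`. So `e` has locality `2` with `v`, one better than
  -- the general bound.
  have h2 : prod (k := k) 2 (Lop k 3 2 (vU k 3)) (vU k 3) = 0 := by
    have h := prod_Lop_one_vU (k := k) 3 (vU k 3)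
    rw [hloc 1 3 le_rfl, Lop_vU_of_le le_rfl, zero_sub, eq_comm, neg_eq_zero] at h
    refine (smul_eq_zero.1 h).resolve_left ?_
    exact mul_ne_zero (inv_ne_zero two_ne_zero) (Nat.cast_ne_zero.2 three_ne_zero)
  rw [Lop_Lop, hloc 0 _ (by omega), hloc 1 _ (by omega), smul_zero, Nat.add_sub_cancel, zero_add,
    zero_add]
  rcases hn.eq_or_lt with rfl | hn
  · rw [h2, smul_zero]
  · rw [hloc 2 _ hn, smul_zero]

/-- A subspace of the envelope that contains `v`, `L_2 v` and is stable under `∂`, `L_0` and `L_1`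
is the whole envelope. -/
theorem eq_top_of_stable_zero_one [CharZero k] (p : Submodule k (VirEnvelope k 3))
    (hv : vU k 3 ∈ p) (he : Lop k 3 2 (vU k 3) ∈ p) (hder : ∀ u ∈ p, der (k := k) u ∈ p)
    (h0 : ∀ u ∈ p, Lop k 3 0 u ∈ p) (h1 : ∀ u ∈ p, Lop k 3 1 u ∈ p) : p = ⊤ := by
  let S : Set (Submodule k (VirEnvelope k 3)) := {p | vU k 3 ∈ p ∧ Lop k 3 2 (vU k 3) ∈ p ∧
    (∀ u ∈ p, der (k := k) u ∈ p) ∧ (∀ u ∈ p, Lop k 3 0 u ∈ p) ∧ ∀ u ∈ p, Lop k 3 1 u ∈ p}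
  have hS : sInf S ∈ S := by
    refine ⟨?_, ?_, ?_, ?_, ?_⟩ <;> simp only [Submodule.mem_sInf]
    · exact fun q hq => hq.1
    · exact fun q hq => hq.2.1
    · exact fun u hu q hq => hq.2.2.1 u (hu q hq)
    · exact fun u hu q hq => hq.2.2.2.1 u (hu q hq)
    · exact fun u hu q hq => hq.2.2.2.2 u (hu q hq)
  obtain ⟨gv, ge, gder, g0, g1⟩ := hS
  -- In the least admissible subspace, the vectors that every `L_n` keeps inside it form an
  -- admissible subspace again, by the commutation relations. By minimality the least subspace is
  -- stable under all `L_n`.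
  have hq : sInf S ⊓ ⨅ n, (sInf S).comap (Lop k 3 n) ∈ S := by
    simp only [S, Set.mem_ofPred_eq, Submodule.mem_inf, Submodule.mem_iInf, Submodule.mem_comap]
    refine ⟨⟨gv, fun n => ?_⟩, ⟨ge, fun n => ?_⟩, ?_, ?_, ?_⟩
    · match n with
      | 0 => exact g0 _ gv
      | 1 => exact g1 _ gv
      | 2 => exact ge
      | n + 3 => rw [Lop_vU_of_le (n := n + 3) (by omega)]; exact zero_mem _
    · match n with
      | 0 => exact g0 _ ge
      | 1 => exact g1 _ ge
      | n + 2 => rw [Lop_Lop_two_vU (n := n + 2) (by omega)]; exact zero_mem _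
    · rintro u ⟨hu, hLu⟩
      refine ⟨gder u hu, fun n => ?_⟩
      rw [Lop_der]
      exact add_mem (gder _ (hLu n)) (Submodule.smul_mem _ _ (hLu _))
    · rintro u ⟨hu, hLu⟩
      refine ⟨g0 u hu, fun n => ?_⟩
      rw [Lop_Lop_zero]
      exact add_mem (g0 _ (hLu n)) (Submodule.smul_mem _ _ (hLu _))
    · rintro u ⟨hu, hLu⟩
      refine ⟨g1 u hu, fun n => ?_⟩
      rw [Lop_Lop_one]
      exact add_mem (g1 _ (hLu n)) (Submodule.smul_mem _ _ (hLu _))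
  have htop : sInf S = ⊤ := eq_top_of_stable _ gv gder fun n u hu =>
    Submodule.mem_comap.1 ((Submodule.mem_iInf _).1 (Submodule.mem_inf.1 (sInf_le hq hu)).2 n)
  exact top_le_iff.1 (htop ▸ sInf_le (show p ∈ S from ⟨hv, he, hder, h0, h1⟩))

/-! ### The two spanning sets -/

theorem Lop_zero_pow_der (n : ℕ) (u : VirEnvelope k 3) :
    (Lop k 3 0 ^ n) (der (k := k) u) = der (k := k) ((Lop k 3 0 ^ n) u) := by
  induction n with
  | zero => rfl
  | succ n ih =>
    rw [pow_succ', Module.End.mul_apply, Module.End.mul_apply, ih, Lop_der]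
    simp

theorem Lop_zero_der_pow (s : ℕ) (u : VirEnvelope k 3) :
    Lop k 3 0 ((der (k := k) ^ s) u) = (der (k := k) ^ s) (Lop k 3 0 u) := by
  induction s with
  | zero => rfl
  | succ s ih =>
    rw [pow_succ', Module.End.mul_apply, Module.End.mul_apply, ← ih, Lop_der]
    simp

theorem Lop_one_Lop_zero_pow [CharZero k] (n : ℕ) (u : VirEnvelope k 3) :
    Lop k 3 1 ((Lop k 3 0 ^ n) u) = (Lop k 3 0 ^ n) (Lop k 3 1 u) + (n : k) • (Lop k 3 0 ^ n) u := by
  induction n with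
  | zero => simp
  | succ n ih =>
    rw [pow_succ', Module.End.mul_apply, Module.End.mul_apply, Lop_Lop_zero, ih, map_add, map_smul]
    push_cast
    module

theorem Lop_one_der_pow (s : ℕ) (u : VirEnvelope k 3) :
    Lop k 3 1 ((der (k := k) ^ s) u) = (der (k := k) ^ s) (Lop k 3 1 u) +
      (s : k) • (der (k := k) ^ (s - 1)) (Lop k 3 0 u) := by
  induction s with
  | zero => simp
  | succ s ih =>
    rw [pow_succ', Module.End.mul_apply, Module.End.mul_apply, Lop_der, ih, map_add, map_smul,
      Nat.sub_self, Lop_zero_der_pow, Nat.add_sub_cancel, ← Module.End.mul_apply (der (k := k)),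
      ← Module.End.mul_apply (der (k := k)), ← pow_succ']
    rcases s with _ | s
    · simp
    · rw [Nat.add_sub_cancel, ← pow_succ']
      push_cast
      module

variable (k) in
/-- The elements `L_0^n ∂^s L_1^m v` and `L_0^n L_1^m L_2 v`. -/
noncomputable def linearFamily : (ℕ × ℕ × ℕ) ⊕ (ℕ × ℕ) → VirEnvelope k 3 :=
  Sum.elim
    (fun p => (Lop k 3 0 ^ p.1) ((der (k := k) ^ p.2.1) ((Lop k 3 1 ^ p.2.2) (vU k 3))))
    (fun p => (Lop k 3 0 ^ p.1) ((Lop k 3 1 ^ p.2) (Lop k 3 2 (vU k 3))))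

variable (k) in
/-- The elements `L_0^n v` and `L_0^n L_1^m L_2 v`. -/
noncomputable def moduleFamily : ℕ ⊕ (ℕ × ℕ) → VirEnvelope k 3 :=
  Sum.elim (fun n => (Lop k 3 0 ^ n) (vU k 3))
    (fun p => (Lop k 3 0 ^ p.1) ((Lop k 3 1 ^ p.2) (Lop k 3 2 (vU k 3))))

theorem span_stable {ι V : Type*} [AddCommGroup V] [Module k V] {b : ι → V} {T : V →ₗ[k] V}
    (h : ∀ i, T (b i) ∈ Submodule.span k (Set.range b)) :
    ∀ u ∈ Submodule.span k (Set.range b), T u ∈ Submodule.span k (Set.range b) := by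
  intro u hu
  have : Submodule.span k (Set.range b) ≤ (Submodule.span k (Set.range b)).comap T :=
    Submodule.span_le.2 (by rintro _ ⟨i, rfl⟩; exact h i)
  exact this hu

/-- Stability under `L_0` is immediate, and `L_1` is commuted past `L_0^n` and `∂^s`. For `∂` the
point is `∂ L_1^m e` with `e = L_2 v`: one has `∂e = 2(L_1 v - v)`, and `∂L_1 = L_1∂ - L_0` gives
the induction on `m`. This is why the second kind needs no powers of `∂`. -/
theorem span_linearFamily [CharZero k] : Submodule.span k (Set.range (linearFamily k)) = ⊤ := by
  set p := Submodule.span k (Set.range (linearFamily k))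
  have hx : ∀ n s m : ℕ,
      (Lop k 3 0 ^ n) ((der (k := k) ^ s) ((Lop k 3 1 ^ m) (vU k 3))) ∈ p := fun n s m =>
    Submodule.subset_span ⟨Sum.inl (n, s, m), rfl⟩
  have hy : ∀ n m : ℕ, (Lop k 3 0 ^ n) ((Lop k 3 1 ^ m) (Lop k 3 2 (vU k 3))) ∈ p := fun n m =>
    Submodule.subset_span ⟨Sum.inr (n, m), rfl⟩
  have h0 : ∀ u ∈ p, Lop k 3 0 u ∈ p := by
    refine span_stable ?_
    rintro (⟨n, s, m⟩ | ⟨n, m⟩)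
    · exact (pow_succ' (Lop k 3 0) n ▸ hx (n + 1) s m :)
    · exact (pow_succ' (Lop k 3 0) n ▸ hy (n + 1) m :)
  have h0' : ∀ n, ∀ u ∈ p, (Lop k 3 0 ^ n) u ∈ p := by
    intro n u hu
    induction n with
    | zero => exact hu
    | succ n ih => rw [pow_succ', Module.End.mul_apply]; exact h0 _ ih
  have h1 : ∀ u ∈ p, Lop k 3 1 u ∈ p := by
    refine span_stable ?_
    rintro (⟨n, s, m⟩ | ⟨n, m⟩)
    · change Lop k 3 1 ((Lop k 3 0 ^ n) _) ∈ p
      rw [Lop_one_Lop_zero_pow, Lop_one_der_pow, map_add, map_smul, ← Lop_zero_der_pow,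
        ← Module.End.mul_apply (Lop k 3 1), ← pow_succ',
        ← Module.End.mul_apply (Lop k 3 0 ^ n) (Lop k 3 0), ← pow_succ]
      exact add_mem (add_mem (hx n s (m + 1)) (p.smul_mem _ (hx (n + 1) (s - 1) m)))
        (p.smul_mem _ (hx n s m))
    · change Lop k 3 1 ((Lop k 3 0 ^ n) _) ∈ p
      rw [Lop_one_Lop_zero_pow, ← Module.End.mul_apply (Lop k 3 1), ← pow_succ']
      exact add_mem (hy n (m + 1)) (p.smul_mem _ (hy n m))
  have hv : vU k 3 ∈ p := hx 0 0 0
  have hde : ∀ m, der (k := k) ((Lop k 3 1 ^ m) (Lop k 3 2 (vU k 3))) ∈ p := by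
    intro m
    induction m with
    | zero =>
      have h : der (k := k) (Lop k 3 2 (vU k 3)) = (2 : k) • (Lop k 3 1 (vU k 3) - vU k 3) := by
        rw [Lop_one_vU, add_sub_cancel_left, smul_inv_smul₀ two_ne_zero]
      change der (k := k) (Lop k 3 2 (vU k 3)) ∈ p
      rw [h]
      exact p.smul_mem _ (sub_mem (h1 _ hv) hv)
    | succ m ih =>
      have h := Lop_der (k := k) 3 1 ((Lop k 3 1 ^ m) (Lop k 3 2 (vU k 3)))
      rw [← sub_eq_iff_eq_add] at h
      rw [pow_succ', Module.End.mul_apply, ← h]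
      exact sub_mem (h1 _ ih) (p.smul_mem _ (hy 1 m))
  have hder : ∀ u ∈ p, der (k := k) u ∈ p := by
    refine span_stable ?_
    rintro (⟨n, s, m⟩ | ⟨n, m⟩)
    · change der (k := k) ((Lop k 3 0 ^ n) _) ∈ p
      rw [← Lop_zero_pow_der, ← Module.End.mul_apply (der (k := k)), ← pow_succ']
      exact hx n (s + 1) m
    · change der (k := k) ((Lop k 3 0 ^ n) _) ∈ p
      rw [← Lop_zero_pow_der]
      exact h0' n _ (hde m)
  exact eq_top_of_stable_zero_one p hv (hy 0 0) hder h0 h1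

/-- With all powers of `∂` admitted, the vectors `L_1^m v` with `m > 0` become redundant, since `L_1
v = v + ∂ L_2 v / 2`. -/
theorem span_der_moduleFamily [CharZero k] : Submodule.span k (Set.range
    fun q : (ℕ ⊕ (ℕ × ℕ)) × ℕ => (der (k := k) ^ q.2) (moduleFamily k q.1)) = ⊤ := by
  set p := Submodule.span k (Set.range
    fun q : (ℕ ⊕ (ℕ × ℕ)) × ℕ => (der (k := k) ^ q.2) (moduleFamily k q.1))
  have hx : ∀ s n : ℕ, (der (k := k) ^ s) ((Lop k 3 0 ^ n) (vU k 3)) ∈ p := fun s n =>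
    Submodule.subset_span ⟨(Sum.inl n, s), rfl⟩
  have hy : ∀ s n m : ℕ, (der (k := k) ^ s)
      ((Lop k 3 0 ^ n) ((Lop k 3 1 ^ m) (Lop k 3 2 (vU k 3)))) ∈ p := fun s n m =>
    Submodule.subset_span ⟨(Sum.inr (n, m), s), rfl⟩
  have hder : ∀ u ∈ p, der (k := k) u ∈ p := by
    refine span_stable ?_
    rintro ⟨n | ⟨n, m⟩, s⟩
    · exact (pow_succ' (der (k := k) (C := VirEnvelope k 3)) s ▸ hx (s + 1) n :)
    · exact (pow_succ' (der (k := k) (C := VirEnvelope k 3)) s ▸ hy (s + 1) n m :)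
  have hder' : ∀ s, ∀ u ∈ p, (der (k := k) ^ s) u ∈ p := by
    intro s u hu
    induction s with
    | zero => exact hu
    | succ s ih => rw [pow_succ', Module.End.mul_apply]; exact hder _ ih
  have h0 : ∀ u ∈ p, Lop k 3 0 u ∈ p := by
    refine span_stable ?_
    rintro ⟨n | ⟨n, m⟩, s⟩
    · change Lop k 3 0 ((der (k := k) ^ s) ((Lop k 3 0 ^ n) _)) ∈ p
      rw [Lop_zero_der_pow, ← Module.End.mul_apply (Lop k 3 0), ← pow_succ']
      exact hx s (n + 1)
    · change Lop k 3 0 ((der (k := k) ^ s) ((Lop k 3 0 ^ n) _)) ∈ p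
      rw [Lop_zero_der_pow, ← Module.End.mul_apply (Lop k 3 0), ← pow_succ']
      exact hy s (n + 1) m
  have h1 : ∀ u ∈ p, Lop k 3 1 u ∈ p := by
    refine span_stable ?_
    rintro ⟨n | ⟨n, m⟩, s⟩
    · change Lop k 3 1 ((der (k := k) ^ s) ((Lop k 3 0 ^ n) (vU k 3))) ∈ p
      rw [Lop_one_der_pow, Lop_one_Lop_zero_pow, Lop_one_vU, map_add (Lop k 3 0 ^ n), map_smul,
        Lop_zero_pow_der]
      exact add_mem (hder' s _ (add_mem (add_mem (hx 0 n)
        (p.smul_mem _ (hder _ (hy 0 n 0)))) (p.smul_mem _ (hx 0 n))))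
        (p.smul_mem _ (hder' _ _ (h0 _ (hx 0 n))))
    · change Lop k 3 1 ((der (k := k) ^ s) ((Lop k 3 0 ^ n) _)) ∈ p
      rw [Lop_one_der_pow, Lop_one_Lop_zero_pow, ← Module.End.mul_apply (Lop k 3 1), ← pow_succ']
      exact add_mem (hder' s _ (add_mem (hy 0 n (m + 1)) (p.smul_mem _ (hy 0 n m))))
        (p.smul_mem _ (hder' _ _ (h0 _ (hy 0 n m))))
  exact eq_top_of_stable_zero_one p (hx 0 0) (hy 0 0 0) hder h0 h1

/-- In `Module.AEval'` of `∂` the variable acts as `∂`, so the `k[X]`-span contains the `k`-span of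
all `∂^s`-translates. -/
theorem span_moduleFamily [CharZero k] : Submodule.span k[X] (Set.range fun i =>
    Module.AEval'.of (der (k := k) (C := VirEnvelope k 3)) (moduleFamily k i)) = ⊤ := by
  set M := Submodule.span k[X] (Set.range fun i =>
    Module.AEval'.of (der (k := k) (C := VirEnvelope k 3)) (moduleFamily k i))
  have h : Submodule.span k (Set.range
      fun q : (ℕ ⊕ (ℕ × ℕ)) × ℕ => (der (k := k) ^ q.2) (moduleFamily k q.1)) ≤
      (M.restrictScalars k).comap (Module.AEval'.of _).toLinearMap := by
    refine Submodule.span_le.2 ?_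
    rintro _ ⟨⟨i, s⟩, rfl⟩
    change Module.AEval'.of (der (k := k) (C := VirEnvelope k 3))
      ((der (k := k) (C := VirEnvelope k 3) ^ s) • moduleFamily k i) ∈ M
    rw [← Module.AEval'.X_pow_smul_of]
    exact M.smul_mem _ (Submodule.subset_span ⟨i, rfl⟩)
  rw [span_der_moduleFamily] at h
  refine Submodule.eq_top_iff'.2 fun u => ?_
  obtain ⟨u, rfl⟩ := (Module.AEval'.of _).surjective u
  exact h (Submodule.mem_top (x := u))

/-! ### Transfer of independence from the model to the envelope -/

variable (k) in
/-- The map `f(∂)v ↦ f(∂)(x - Δ∂)`. -/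
noncomputable def toModel : Vir k →ₗ[k] DensityModel k :=
  LinearMap.mulRight k (vM k) ∘ₗ (aeval (X : DensityModel k)).toLinearMap

theorem toModel_apply (f : k[X]) :
    toModel k f = aeval (X : DensityModel k) f * vM k := rfl

theorem toModel_v : toModel k (v k) = vM k := by
  rw [v, toModel_apply, map_one, one_mul]

theorem toModel_der (f : Vir k) :
    toModel k (der (k := k) f) = der (k := k) (toModel k f) := by
  have h : der (k := k) f = (X * f : k[X]) := rfl
  rw [h, toModel_apply, toModel_apply, der_model, map_mul, aeval_X, mul_assoc]

variable (k) in
/-- The envelope `U(Vir; v, 3)` acts on densities. -/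
theorem exists_isHom_model [CharZero k] : ∃ f : VirEnvelope k 3 →ₗ[k] DensityModel k,
    IsHom f ∧ f (vU k 3) = vM k := by
  obtain ⟨f, hf, hfv⟩ := Envelope.exists_isHom (φ := toModel k) (hX := generatesModule k)
    (N := fun _ _ => 3) toModel_der
    (by
      rintro ⟨_, rfl⟩ ⟨_, rfl⟩ n hn
      rw [toModel_v]
      exact prod_vM_vM_of_le hn)
    (by
      rintro ⟨_, rfl⟩ ⟨_, rfl⟩ n
      rw [toModel_v, commutator_vM, prod_v_v]
      split_ifs
      · rw [toModel_der, toModel_v]; rfl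
      · rw [map_smul, toModel_v]
      · rw [map_zero])
  exact ⟨f, hf, (hfv _).trans toModel_v⟩

section

variable {f : VirEnvelope k 3 →ₗ[k] DensityModel k}

theorem map_Lop_pow (hf : IsHom f) (hv : f (vU k 3) = vM k) (n m : ℕ) (u : VirEnvelope k 3) :
    f ((Lop k 3 n ^ m) u) = (prod (k := k) n (vM k) ^ m) (f u) := by
  induction m with
  | zero => rfl
  | succ m ih =>
    rw [pow_succ', pow_succ', Module.End.mul_apply, Module.End.mul_apply, ← ih, ← hv, ← hf.map_prod]
    rfl

theorem map_der_pow (hf : IsHom f) (m : ℕ) (u : VirEnvelope k 3) :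
    f ((der (k := k) ^ m) u) = (der (k := k) ^ m) (f u) := by
  induction m with
  | zero => rfl
  | succ m ih =>
    rw [pow_succ', pow_succ', Module.End.mul_apply, Module.End.mul_apply, ← ih, ← hf.map_der]

theorem map_Lop_two_vU (hf : IsHom f) (hv : f (vU k 3) = vM k) :
    f (Lop k 3 2 (vU k 3)) = prod (k := k) 2 (vM k) (vM k) := by
  rw [← hv, ← hf.map_prod]
  rfl

end

/-- The homomorphism to the model intertwines `∂` and the `L_n`, so it carries this family to the
independent one there. -/
theorem linearIndependent_linearFamily [CharZero k] : LinearIndependent k (linearFamily k) := by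
  obtain ⟨f, hf, hv⟩ := exists_isHom_model k
  refine LinearIndependent.of_comp f ?_
  convert linearIndependent_model (k := k) using 1
  funext i
  rcases i with ⟨n, s, m⟩ | ⟨n, m⟩
  · simp only [Function.comp_apply, linearFamily, Sum.elim_inl, map_Lop_pow hf hv, map_der_pow hf,
      hv]
  · simp only [Function.comp_apply, linearFamily, Sum.elim_inr, map_Lop_pow hf hv,
      map_Lop_two_vU hf hv]

/-- Independence over `k[X]` amounts to independence over `k` of all `∂^s`-translates, which again
is visible in the model. -/
theorem linearIndependent_moduleFamily [CharZero k] : LinearIndependent k[X] fun i =>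
    Module.AEval'.of (der (k := k) (C := VirEnvelope k 3)) (moduleFamily k i) := by
  obtain ⟨f, hf, hv⟩ := exists_isHom_model k
  refine Module.AEval'.linearIndependent_of_pow _ _ (LinearIndependent.of_comp f ?_)
  convert linearIndependent_model_der (k := k) using 1
  funext ⟨i, s⟩
  rcases i with n | ⟨n, m⟩
  · simp only [Function.comp_apply, moduleFamily, Sum.elim_inl, map_Lop_pow hf hv, map_der_pow hf,
      hv]
  · simp only [Function.comp_apply, moduleFamily, Sum.elim_inr, map_Lop_pow hf hv, map_der_pow hf,
      map_Lop_two_vU hf hv]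

end Vir

end ConformalAlgebra

theorem mainTheorem7 (k : Type*) [Field k] [CharZero k] :
    (∃ b : Module.Basis ((ℕ × ℕ × ℕ) ⊕ (ℕ × ℕ)) k (Vir.VirEnvelope k 3),
      (∀ n s m : ℕ, b (Sum.inl (n, s, m)) =
        (Vir.Lop k 3 0 ^ n) ((der (k := k) ^ s) ((Vir.Lop k 3 1 ^ m) (Vir.vU k 3)))) ∧
      (∀ n m : ℕ, b (Sum.inr (n, m)) =
        (Vir.Lop k 3 0 ^ n) ((Vir.Lop k 3 1 ^ m) (Vir.Lop k 3 2 (Vir.vU k 3))))) ∧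
    (∃ b : Module.Basis (ℕ ⊕ (ℕ × ℕ)) k[X]
        (Module.AEval' (der (k := k) (C := Vir.VirEnvelope k 3))),
      (∀ n : ℕ, b (Sum.inl n) = Module.AEval'.of _ ((Vir.Lop k 3 0 ^ n) (Vir.vU k 3))) ∧
      (∀ n m : ℕ, b (Sum.inr (n, m)) = Module.AEval'.of _
        ((Vir.Lop k 3 0 ^ n) ((Vir.Lop k 3 1 ^ m) (Vir.Lop k 3 2 (Vir.vU k 3)))))) := by
  refine ⟨⟨Module.Basis.mk Vir.linearIndependent_linearFamily Vir.span_linearFamily.ge, ?_, ?_⟩,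
    ⟨Module.Basis.mk Vir.linearIndependent_moduleFamily Vir.span_moduleFamily.ge, ?_, ?_⟩⟩
  · exact fun n s m => Module.Basis.mk_apply _ _ _
  · exact fun n m => Module.Basis.mk_apply _ _ _
  · exact fun n => Module.Basis.mk_apply _ _ _
  · exact fun n m => Module.Basis.mk_apply _ _ _
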